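/- Let $G$ be a group acting by isometries on a geodesic metric space $S$ that is Gromov hyperbolic, i.e. for some $\delta$ one has $\langle x|y\rangle_o\ge\min\{\langle x|z\rangle_o,\langle z|y\rangle_o\}-\delta$ for all $x,y,z,o\in S$, where $\langle x|y\rangle_o=\tfrac12(d(x,o)+d(y,o)-d(x,y))$. Let $\partial S$ be the Gromov boundary of $S$ (equivalence classes of sequences $(x_i)$ with $\langle x_i|x_j\rangle_o\to\infty$, where $(x_i)\sim(y_i)$ if $\langle x_i|y_j\rangle_o\to\infty$), and give $\widehat S=S\cup\partial S$ its usual topology. The limit set $\Lambda_S(G)$ is the intersection of $\partial S$ with the closure in $\widehat S$ of an orbit $Gs$ (it does not depend on $s\in S$). An element $g\in G$ is loxodromic if $\langle g\rangle$ has unbounded orbits in $S$ and fixes exactly two points of $\partial S$. The action of $G$ on $S$ is of general type if its orbits are unbounded and $G$ contains two loxodromic elements with disjoint sets of fixed points on $\partial S$. A group is faithful weakly hyperbolic if it admits an isometric action of general type on some geodesic Gromov hyperbolic space such that the induced action on the limit set of that action is faithful. Suppose that the action of $G$ on $S$ is of general type, and let $E_S(G)=\{g\in G \mid ga=a \text{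 for all } a\in\Lambda_S(G)\}$ be its elliptic radical, which is a normal subgroup of $G$. Then the quotient group $G/E_S(G)$ is faithful weakly hyperbolic. -/

import Mathlib

open Filter Topology

universe u v

namespace WeakHyp

/-- The Gromov product `⟨x|y⟩_o` in a metric space. -/
noncomputable def gromovProduct {S : Type v} [MetricSpace S] (o x y : S) : ℝ :=
  (dist x o + dist y o - dist x y) / 2

/-- Any two points are joined by an isometrically embedded interval. -/
def IsGeodesicSpace (S : Type v) [MetricSpace S] : Prop :=
  ∀ x y : S, ∃ γ : ℝ → S, γ 0 = x ∧ γ (dist x y) = y ∧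
    ∀ s ∈ Set.Icc 0 (dist x y), ∀ t ∈ Set.Icc 0 (dist x y), dist (γ s) (γ t) = |s - t|

/-- Geodesic Gromov hyperbolic metric spaces (four-point condition for some `δ`). -/
class HyperbolicSpace (S : Type v) [MetricSpace S] : Prop where
  geodesic : IsGeodesicSpace S
  hyperbolic : ∃ δ : ℝ, ∀ x y z o : S,
    min (gromovProduct o x z) (gromovProduct o z y) - δ ≤ gromovProduct o x y

/-- `⟨x_i|y_j⟩_o → ∞` as `i, j → ∞`, for every base point `o`. -/
def ProductTendsToInfinity {S : Type v} [MetricSpace S] (x y : ℕ → S) : Prop :=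
  ∀ o : S, Tendsto (fun p : ℕ × ℕ => gromovProduct o (x p.1) (y p.2)) atTop atTop

/-- Sequences that converge at infinity. -/
def SeqAtInfinity (S : Type v) [MetricSpace S] : Type v :=
  {x : ℕ → S // ProductTendsToInfinity x x}

section Product

variable {S : Type v} [MetricSpace S]

theorem gromovProduct_comm (o x y : S) : gromovProduct o x y = gromovProduct o y x := by
  unfold gromovProduct
  rw [dist_comm x y]
  ring

theorem ProductTendsToInfinity.symm {x y : ℕ → S} (h : ProductTendsToInfinity x y) :
    ProductTendsToInfinity y x := by
  intro o
  have h1 : Tendsto (Prod.swap : ℕ × ℕ → ℕ × ℕ) atTop atTop := by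
    rw [← prod_atTop_atTop_eq]
    exact tendsto_prod_swap
  refine ((h o).comp h1).congr ?_
  intro p
  exact gromovProduct_comm _ _ _

theorem ProductTendsToInfinity.trans [HyperbolicSpace S] {x y z : ℕ → S}
    (h : ProductTendsToInfinity x y) (h' : ProductTendsToInfinity y z) :
    ProductTendsToInfinity x z := by
  intro o
  obtain ⟨δ, hδ⟩ := HyperbolicSpace.hyperbolic (S := S)
  rw [tendsto_atTop]
  intro b
  have h1 := (tendsto_atTop.1 (h o)) (b + δ)
  have h2 := (tendsto_atTop.1 (h' o)) (b + δ)
  rw [eventually_atTop] at h1 h2 ⊢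
  obtain ⟨⟨a1, a2⟩, h1⟩ := h1
  obtain ⟨⟨b1, b2⟩, h2⟩ := h2
  refine ⟨(a1, b2), ?_⟩
  rintro ⟨i, k⟩ ⟨hi, hk⟩
  have e1 := h1 (i, max a2 b1) ⟨hi, le_max_left _ _⟩
  have e2 := h2 (max a2 b1, k) ⟨le_max_right _ _, hk⟩
  have e3 := hδ (x i) (z k) (y (max a2 b1)) o
  have e4 := le_min e1 e2
  simp only at e4 ⊢
  linarith

end Product

/-- Two sequences converging at infinity are equivalent if `⟨x_i|y_j⟩_o → ∞`. -/
instance seqSetoid (S : Type v) [MetricSpace S] [HyperbolicSpace S] :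
    Setoid (SeqAtInfinity S) where
  r x y := ProductTendsToInfinity x.1 y.1
  iseqv := ⟨fun x => x.2, fun h => h.symm, fun h h' => h.trans h'⟩

/-- The Gromov boundary `∂S`. -/
def Boundary (S : Type v) [MetricSpace S] [HyperbolicSpace S] : Type v :=
  Quotient (seqSetoid S)

/-- The point of the boundary to which a sequence converges. -/
def SeqAtInfinity.limit {S : Type v} [MetricSpace S] [HyperbolicSpace S]
    (x : SeqAtInfinity S) : Boundary S :=
  Quotient.mk (seqSetoid S) x

/-- The bordification `Ŝ = S ∪ ∂S`. -/
inductive Bordification (S : Type v) [MetricSpace S] [HyperbolicSpace S] : Type v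
  | point (x : S) : Bordification S
  | ideal (a : Boundary S) : Bordification S

/-- The Gromov product `⟨a|p⟩_o` of a boundary point `a` and a point `p` of `Ŝ`, with values
in the extended reals. -/
noncomputable def extProduct {S : Type v} [MetricSpace S] [HyperbolicSpace S] (o : S)
    (a : Boundary S) : Bordification S → EReal
  | .point x => ⨅ s : {s : SeqAtInfinity S // s.limit = a},
      liminf (fun i : ℕ => (gromovProduct o (s.1.1 i) x : EReal)) atTop
  | .ideal b => ⨅ s : {s : SeqAtInfinity S // s.limit = a},
      ⨅ t : {t : SeqAtInfinity S // t.limit = b},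
        liminf (fun p : ℕ × ℕ => (gromovProduct o (s.1.1 p.1) (t.1.1 p.2) : EReal)) atTop

/-- The set `U_o(a, r)` of all `p` in `Ŝ` with `⟨a|p⟩_o > r`. -/
def basicNhd {S : Type v} [MetricSpace S] [HyperbolicSpace S] (o : S) (a : Boundary S) (r : ℝ) :
    Set (Bordification S) :=
  {p | (r : EReal) < extProduct o a p}

/-- The topology of `Ŝ`: it extends the topology of `S`, and the sets `U_o(a, r)` form a
neighbourhood base at the boundary point `a`. -/
instance bordificationTopology (S : Type v) [MetricSpace S] [HyperbolicSpace S] :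
    TopologicalSpace (Bordification S) where
  IsOpen U := IsOpen {x : S | Bordification.point x ∈ U} ∧
    ∀ a : Boundary S, Bordification.ideal a ∈ U → ∀ o : S, ∃ r : ℝ, basicNhd o a r ⊆ U
  isOpen_univ := ⟨by simp, fun _ _ _ => ⟨0, Set.subset_univ _⟩⟩
  isOpen_inter := by
    rintro U V ⟨hU, hU'⟩ ⟨hV, hV'⟩
    refine ⟨hU.inter hV, ?_⟩
    rintro a ⟨haU, haV⟩ o
    obtain ⟨r, hr⟩ := hU' a haU o
    obtain ⟨t, ht⟩ := hV' a haV o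
    refine ⟨max r t, fun p hp => ⟨hr ?_, ht ?_⟩⟩
    · exact lt_of_le_of_lt (EReal.coe_le_coe_iff.2 (le_max_left r t)) hp
    · exact lt_of_le_of_lt (EReal.coe_le_coe_iff.2 (le_max_right r t)) hp
  isOpen_sUnion := by
    intro C hC
    constructor
    · have h : {x : S | Bordification.point x ∈ ⋃₀ C} =
          ⋃ U ∈ C, {x : S | Bordification.point x ∈ U} := by
        ext x
        simp
      rw [h]
      exact isOpen_biUnion fun U hU => (hC U hU).1
    · rintro a ⟨U, hU, haU⟩ o
      obtain ⟨r, hr⟩ := (hC U hU).2 a haU o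
      exact ⟨r, hr.trans (Set.subset_sUnion_of_mem hU)⟩

section Action

variable {G : Type u} [Group G] {S : Type v} [MetricSpace S] [MulAction G S] [IsIsometricSMul G S]

theorem gromovProduct_smul (g : G) (o x y : S) :
    gromovProduct (g • o) (g • x) (g • y) = gromovProduct o x y := by
  simp [gromovProduct, dist_smul]

theorem ProductTendsToInfinity.smul {x y : ℕ → S} (h : ProductTendsToInfinity x y) (g : G) :
    ProductTendsToInfinity (fun i => g • x i) (fun i => g • y i) := by
  intro o
  refine (h (g⁻¹ • o)).congr ?_
  intro p
  rw [← gromovProduct_smul g, smul_inv_smul]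

instance seqAction : MulAction G (SeqAtInfinity S) where
  smul g x := ⟨fun i => g • x.1 i, x.2.smul g⟩
  one_smul x := Subtype.ext (funext fun i => one_smul G (x.1 i))
  mul_smul g h x := Subtype.ext (funext fun i => mul_smul g h (x.1 i))

variable [HyperbolicSpace S]

/-- The action on the Gromov boundary induced by an isometric action on `S`. -/
instance boundaryAction : MulAction G (Boundary S) where
  smul g := Quotient.map (fun x : SeqAtInfinity S => g • x) (fun _ _ h => h.smul g)
  one_smul a := Quotient.inductionOn a fun x =>
    congrArg (Quotient.mk (seqSetoid S)) (one_smul G x)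
  mul_smul g h a := Quotient.inductionOn a fun x =>
    congrArg (Quotient.mk (seqSetoid S)) (mul_smul g h x)

theorem limit_smul (g : G) (x : SeqAtInfinity S) : (g • x).limit = g • x.limit := rfl

end Action

/-- The limit set `Λ_S(G)`: the boundary points that lie in the closure in `Ŝ` of the orbit
`Gs` (which does not depend on the point `s`). -/
def limitSet (G : Type u) [Group G] (S : Type v) [MetricSpace S] [HyperbolicSpace S]
    [MulAction G S] : Set (Boundary S) :=
  {a | ∀ s : S, Bordification.ideal a ∈ closure (Bordification.point '' MulAction.orbit G s)}

section Invariance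

variable {G : Type u} [Group G] {S : Type v} [MetricSpace S] [HyperbolicSpace S] [MulAction G S]
  [IsIsometricSMul G S]

/-- The homeomorphism of `Ŝ` induced by `g`. -/
def bordificationMap (g : G) : Bordification S → Bordification S
  | .point x => .point (g • x)
  | .ideal a => .ideal (g • a)

theorem extProduct_smul_le (g : G) (o : S) (a : Boundary S) (p : Bordification S) :
    extProduct o a p ≤ extProduct (g • o) (g • a) (bordificationMap g p) := by
  have key : ∀ (b : Boundary S) (s : {s : SeqAtInfinity S // s.limit = g • b}),
      (g⁻¹ • s.1).limit = b := by
    intro b s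
    rw [limit_smul, s.2, inv_smul_smul]
  have hp : ∀ x y : S, gromovProduct o (g⁻¹ • x) (g⁻¹ • y) = gromovProduct (g • o) x y := by
    intro x y
    rw [← gromovProduct_smul g, smul_inv_smul, smul_inv_smul]
  cases p with
  | point x =>
    refine le_iInf fun s => ?_
    refine (iInf_le _ ⟨g⁻¹ • s.1, key a s⟩).trans (le_of_eq ?_)
    refine congrArg (fun f : ℕ → EReal => liminf f atTop) (funext fun i => ?_)
    have := hp (s.1.1 i) (g • x)
    rw [inv_smul_smul] at this
    exact congrArg _ this
  | ideal b =>
    refine le_iInf fun s => le_iInf fun t => ?_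
    refine (iInf_le _ ⟨g⁻¹ • s.1, key a s⟩).trans ?_
    refine (iInf_le _ ⟨g⁻¹ • t.1, key b t⟩).trans (le_of_eq ?_)
    refine congrArg (fun f : ℕ × ℕ → EReal => liminf f atTop) (funext fun i => ?_)
    exact congrArg _ (hp (s.1.1 i.1) (t.1.1 i.2))

theorem continuous_bordificationMap (g : G) :
    Continuous (bordificationMap g : Bordification S → Bordification S) := by
  refine ⟨fun U hU => ⟨?_, fun a ha o => ?_⟩⟩
  · exact hU.1.preimage (continuous_const_smul g)
  · obtain ⟨r, hr⟩ := hU.2 (g • a) ha (g • o)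
    exact ⟨r, fun p hp => hr (lt_of_lt_of_le hp (extProduct_smul_le g o a p))⟩

theorem smul_mem_limitSet (g : G) {a : Boundary S} (ha : a ∈ limitSet G S) :
    g • a ∈ limitSet G S := by
  intro s
  have h := map_mem_closure (continuous_bordificationMap g) (ha s)
    (t := Bordification.point '' MulAction.orbit G s)
  refine h ?_
  rintro _ ⟨x, ⟨h, rfl⟩, rfl⟩
  exact ⟨g • h • s, ⟨g * h, mul_smul g h s⟩, rfl⟩

end Invariance

/-- The elliptic radical `E_S(G)`. -/
def ellipticRadical (G : Type u) [Group G] (S : Type v) [MetricSpace S] [HyperbolicSpace S]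
    [MulAction G S] [IsIsometricSMul G S] : Subgroup G where
  carrier := {g | ∀ a ∈ limitSet G S, g • a = a}
  one_mem' a _ := one_smul G a
  mul_mem' {g h} hg hh a ha := by rw [mul_smul, hh a ha, hg a ha]
  inv_mem' {g} hg a ha := by
    rw [inv_smul_eq_iff]
    exact (hg a ha).symm

instance ellipticRadical_normal (G : Type u) [Group G] (S : Type v) [MetricSpace S]
    [HyperbolicSpace S] [MulAction G S] [IsIsometricSMul G S] :
    (ellipticRadical G S).Normal where
  conj_mem n hn g a ha := by
    rw [mul_smul, mul_smul, hn _ (smul_mem_limitSet g⁻¹ ha), smul_inv_smul]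

/-- `g` is loxodromic: the cyclic group it generates has unbounded orbits and fixes exactly two
boundary points. -/
def IsLoxodromic {G : Type u} [Group G] (S : Type v) [MetricSpace S] [HyperbolicSpace S]
    [MulAction G S] [IsIsometricSMul G S] (g : G) : Prop :=
  (∀ s : S, ¬ Bornology.IsBounded (MulAction.orbit (Subgroup.zpowers g) s)) ∧
    {a : Boundary S | ∀ h ∈ Subgroup.zpowers g, h • a = a}.encard = 2

/-- An isometric action on a hyperbolic space is of general type if its orbits are unbounded and
there are two loxodromic elements without a common fixed point on the boundary. -/
def IsGeneralType (G : Type u) [Group G] (S : Type v) [MetricSpace S] [HyperbolicSpace S]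
    [MulAction G S] [IsIsometricSMul G S] : Prop :=
  (∀ s : S, ¬ Bornology.IsBounded (MulAction.orbit G s)) ∧
    ∃ g h : G, IsLoxodromic S g ∧ IsLoxodromic S h ∧
      ¬ ∃ a : Boundary S, g • a = a ∧ h • a = a

/-- `G` admits a general type action on a hyperbolic space such that the induced action on the
limit set is faithful. -/
def IsFaithfulWeaklyHyperbolic (G : Type u) [Group G] : Prop :=
  ∃ (S : Type v) (_ : MetricSpace S) (_ : HyperbolicSpace S) (_ : MulAction G S)
    (_ : IsIsometricSMul G S),
    IsGeneralType G S ∧ ∀ g : G, (∀ a ∈ limitSet G S, g • a = a) → g = 1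

end WeakHyp

/-!
Let `E` be the elliptic radical, `s` a point of `S` and `X` the orbit of `s`. An isometry that
fixes three boundary points moves `s` by a bounded amount (`exists_dist_smul_le_of_fixes_three`),
because it moves a coarse centre of the ideal triangle to another one. As `E` fixes the limit set,
which has at least three points, the orbit `E s` is bounded; as `E` is normal, all orbits of `E`
in `X` are uniformly bounded. Hence the pseudometric on `X` given by the distance of `E`-orbits
differs from the metric of `S` by a bounded amount, and it satisfies a four-point inequality.

The space on which `G ⧸ E` acts is the injective hull of `X` with this pseudometric, that is, the
space of extremal functions on `X` with the supremum metric. It is geodesic since straight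
segments of functions can be retracted to it (`isGeodesicSpace_injectiveHull`), it inherits the
four-point inequality (`hyperbolicSpace_injectiveHull`), and `E` acts trivially on it because
extremal functions are constant on `E`-orbits. The image of `X` in the hull need not be cobounded,
so the boundary of the hull is never compared with that of `S` as a whole: only sequences in the
orbits are.

The orbit map from `X` to the hull is a rough isometry, so sequences in `X` converge at infinity,
and have equal limits, in `S` exactly if they do so in the hull. Points of limit sets are limits
of sequences in an orbit (`exists_limit_eq_of_mem_limitSet`), which yields faithfulness. A
loxodromic element of `G` has a power whose positive and negative iterates of `s` converge to its
two fixed points (`exists_mem_zpowers_productTendsToInfinity`, by means of Busemann functions).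
Conversely such convergence forces an element to be loxodromic, as a third fixed point would make
its orbits bounded (`isLoxodromic_of_productTendsToInfinity`). So loxodromic elements without
common fixed points are carried over to the hull.
-/

namespace WeakHyp

/-! ### Gromov products and sequences converging at infinity -/

section Products

variable {S : Type v} [MetricSpace S]

theorem gromovProduct_le_add_dist (o o' x y : S) :
    gromovProduct o' x y ≤ gromovProduct o x y + dist o o' := by
  unfold gromovProduct
  have h1 := dist_triangle x o o'
  have h2 := dist_triangle y o o'
  linarith

theorem gromovProduct_le_add_dist_right (o x y y' : S) :
    gromovProduct o x y' ≤ gromovProduct o x y + dist y y' := by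
  unfold gromovProduct
  have h1 := dist_triangle y' y o
  have h2 := dist_triangle x y' y
  rw [dist_comm y' y] at h1 h2
  linarith

theorem gromovProduct_le_add_dist_left (o x x' y : S) :
    gromovProduct o x' y ≤ gromovProduct o x y + dist x x' := by
  rw [gromovProduct_comm o x', gromovProduct_comm o x]
  exact gromovProduct_le_add_dist_right o y x x'

theorem gromovProduct_le_dist (o x y : S) : gromovProduct o x y ≤ dist o x := by
  unfold gromovProduct
  have h1 := dist_triangle y x o
  rw [dist_comm y x] at h1
  rw [dist_comm o x]
  linarith

theorem gromovProduct_self (o x : S) : gromovProduct o x x = dist x o := by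
  unfold gromovProduct
  rw [dist_self]
  ring

theorem gromovProduct_add_swap (p q x : S) :
    gromovProduct p q x + gromovProduct q p x = dist p q := by
  unfold gromovProduct
  rw [dist_comm q p, dist_comm x p, dist_comm x q]
  ring

theorem dist_sub_dist_eq (p q x : S) :
    dist q x - dist p x = dist p q - 2 * gromovProduct p q x := by
  unfold gromovProduct
  rw [dist_comm q p, dist_comm x p]
  ring

theorem productTendsToInfinity_iff (o : S) {x y : ℕ → S} :
    ProductTendsToInfinity x y ↔
      ∀ b : ℝ, ∃ N : ℕ, ∀ i ≥ N, ∀ j ≥ N, b ≤ gromovProduct o (x i) (y j) := by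
  constructor
  · intro h b
    obtain ⟨⟨m, n⟩, hN⟩ := eventually_atTop.1 (tendsto_atTop.1 (h o) b)
    exact ⟨max m n, fun i hi j hj =>
      hN (i, j) ⟨(le_max_left m n).trans hi, (le_max_right m n).trans hj⟩⟩
  · intro h o'
    rw [tendsto_atTop]
    intro b
    obtain ⟨N, hN⟩ := h (b + dist o' o)
    refine eventually_atTop.2 ⟨(N, N), fun p hp => ?_⟩
    have h1 := hN p.1 hp.1 p.2 hp.2
    have h2 := gromovProduct_le_add_dist o' o (x p.1) (y p.2)
    linarith

/-- Convergence at infinity only depends on the sequences up to bounded distance. -/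
theorem ProductTendsToInfinity.of_dist_le {x x' y : ℕ → S} (h : ProductTendsToInfinity x y)
    {C : ℝ} (hC : ∀ i, dist (x i) (x' i) ≤ C) : ProductTendsToInfinity x' y := by
  rw [productTendsToInfinity_iff (x 0)] at h ⊢
  intro b
  obtain ⟨N, hN⟩ := h (b + C)
  refine ⟨N, fun i hi j hj => ?_⟩
  have h1 := hN i hi j hj
  have h2 := gromovProduct_le_add_dist_left (x 0) (x' i) (x i) (y j)
  rw [dist_comm] at h2
  linarith [hC i]

/-- Two parametrized families of points with roughly the same mutual distances have the same
sequences converging at infinity. -/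
theorem ProductTendsToInfinity.of_roughly_isometric {T : Type*} [MetricSpace T] {P : Type*}
    {F : P → S} {F' : P → T} {C : ℝ} (hC : ∀ p q, |dist (F p) (F q) - dist (F' p) (F' q)| ≤ C)
    {x y : ℕ → P} (h : ProductTendsToInfinity (fun i => F (x i)) (fun i => F (y i))) :
    ProductTendsToInfinity (fun i => F' (x i)) (fun i => F' (y i)) := by
  rw [productTendsToInfinity_iff (F (x 0))] at h
  rw [productTendsToInfinity_iff (F' (x 0))]
  intro b
  obtain ⟨N, hN⟩ := h (b + 2 * C)
  refine ⟨N, fun i hi j hj => ?_⟩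
  have h0 := hN i hi j hj
  have h1 := abs_le.1 (hC (x i) (x 0))
  have h2 := abs_le.1 (hC (y j) (x 0))
  have h3 := abs_le.1 (hC (x i) (y j))
  unfold gromovProduct at h0 ⊢
  linarith [h1.1, h1.2, h2.1, h2.2, h3.1, h3.2]

theorem limit_eq_limit_iff [HyperbolicSpace S] {x y : SeqAtInfinity S} :
    x.limit = y.limit ↔ ProductTendsToInfinity x.1 y.1 :=
  Quotient.eq

theorem exists_limit_eq [HyperbolicSpace S] (a : Boundary S) : ∃ x : SeqAtInfinity S, x.limit = a :=
  Quotient.exists_rep a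

/-- The boundary point to which a sequence of points of `S` converges, the convergence at infinity
being given by a proof. -/
def ProductTendsToInfinity.limit [HyperbolicSpace S] {x : ℕ → S}
    (h : ProductTendsToInfinity x x) : Boundary S :=
  SeqAtInfinity.limit ⟨x, h⟩

theorem ProductTendsToInfinity.limit_eq_iff [HyperbolicSpace S] {x y : ℕ → S}
    (hx : ProductTendsToInfinity x x) (hy : ProductTendsToInfinity y y) :
    hx.limit = hy.limit ↔ ProductTendsToInfinity x y :=
  Quotient.eq

theorem ProductTendsToInfinity.limit_eq_seq_limit_iff [HyperbolicSpace S] {x : ℕ → S}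
    {y : SeqAtInfinity S} (hx : ProductTendsToInfinity x x) :
    hx.limit = y.limit ↔ ProductTendsToInfinity x y.1 :=
  Quotient.eq

/-- The hyperbolicity inequality with a given constant `δ`. -/
def FourPoint (S : Type v) [MetricSpace S] (δ : ℝ) : Prop :=
  ∀ x y z o : S, min (gromovProduct o x z) (gromovProduct o z y) - δ ≤ gromovProduct o x y

theorem FourPoint.nonneg {δ : ℝ} (hδ : FourPoint S δ) (o : S) : 0 ≤ δ := by
  have h := hδ o o o o
  rw [gromovProduct_self, dist_self, min_self] at h
  linarith

/-- The symmetric form of the hyperbolicity inequality, which does not single out a base point. -/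
theorem FourPoint.dist_add_dist_le {δ : ℝ} (hδ : FourPoint S δ)
    (x y z w : S) :
    dist x y + dist z w ≤ max (dist x z + dist y w) (dist x w + dist y z) + 2 * δ := by
  have h := hδ x y z w
  unfold gromovProduct at h
  rw [sub_le_iff_le_add, min_le_iff] at h
  rw [← sub_le_iff_le_add, le_max_iff]
  rw [dist_comm z y] at h
  rcases h with h | h
  · left
    linarith
  · right
    linarith

/-- A small Gromov product stays small when the two points are replaced by points that are
close to them as seen from the base point. -/
theorem FourPoint.gromovProduct_le {δ K : ℝ} (hδ : FourPoint S δ) {o x x' y y' : S}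
    (h : gromovProduct o x y ≤ K) (hx : K + 2 * δ < gromovProduct o x x')
    (hy : K + 2 * δ < gromovProduct o y y') : gromovProduct o x' y' ≤ K + 2 * δ := by
  have h0 := hδ.nonneg o
  by_contra! hc
  have h1 := hδ x' y y' o
  have h2 := hδ x y x' o
  rw [gromovProduct_comm o y' y] at h1
  have h3 := lt_min hc hy
  have h4 : K + δ < min (gromovProduct o x x') (gromovProduct o x' y) :=
    lt_min (by linarith) (by linarith)
  linarith

/-- Busemann functions, up to an additive error: the difference of the distances of two points
from a third one `x` hardly changes when `x` moves near infinity. -/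
theorem FourPoint.dist_sub_dist_le {δ : ℝ} (hδ : FourPoint S δ) {p q x x' : S}
    (h : dist p q ≤ gromovProduct p x' x) :
    dist q x - dist p x ≤ dist q x' - dist p x' + 2 * δ := by
  rw [dist_sub_dist_eq, dist_sub_dist_eq]
  have h1 := hδ q x x' p
  rw [min_eq_left ((gromovProduct_le_dist p q x').trans h)] at h1
  linarith

/-- Two coarse centres of the same ideal triangle are close to each other: among the three
vertices there is one that lies neither behind `q` as seen from `p` nor behind `p` as seen
from `q`. -/
theorem FourPoint.dist_le_of_gromovProduct_le {δ K : ℝ} (hδ : FourPoint S δ) {p q x y z : S}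
    (h1 : gromovProduct p x y ≤ K) (h2 : gromovProduct p x z ≤ K) (h3 : gromovProduct p y z ≤ K)
    (h4 : gromovProduct q x y ≤ K) (h5 : gromovProduct q x z ≤ K)
    (h6 : gromovProduct q y z ≤ K) : dist p q ≤ 2 * K + 2 * δ := by
  have key : ∀ {o r u w : S}, gromovProduct o u w ≤ K →
      gromovProduct o r u ≤ K + δ ∨ gromovProduct o r w ≤ K + δ := by
    intro o r u w h
    have h' := hδ u w r o
    rw [gromovProduct_comm o u r] at h'
    exact min_le_iff.1 (by linarith)
  have ex := gromovProduct_add_swap p q x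
  have ey := gromovProduct_add_swap p q y
  have ez := gromovProduct_add_swap p q z
  rcases key (r := q) h1 with a1 | a1 <;> rcases key (r := q) h2 with a2 | a2 <;>
    rcases key (r := q) h3 with a3 | a3 <;> rcases key (r := p) h4 with a4 | a4 <;>
    rcases key (r := p) h5 with a5 | a5 <;> rcases key (r := p) h6 with a6 | a6 <;> linarith

/-- Sequences with different limits have bounded Gromov products. -/
theorem FourPoint.exists_gromovProduct_le {δ : ℝ} (hδ : FourPoint S δ) (o : S) {x y : ℕ → S}
    (hx : ProductTendsToInfinity x x) (hy : ProductTendsToInfinity y y)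
    (hxy : ¬ ProductTendsToInfinity x y) :
    ∃ K : ℝ, ∃ N : ℕ, ∀ i ≥ N, ∀ j ≥ N, gromovProduct o (x i) (y j) ≤ K := by
  rw [productTendsToInfinity_iff o] at hx hy hxy
  push Not at hxy
  obtain ⟨b, hb⟩ := hxy
  obtain ⟨N, hN⟩ := hx (b + 2 * δ + 1)
  obtain ⟨M, hM⟩ := hy (b + 2 * δ + 1)
  refine ⟨b + 2 * δ, max N M, fun i hi j hj => ?_⟩
  obtain ⟨k, hk, l, hl, hkl⟩ := hb (max N M)
  have h1 := hN k (le_of_max_le_left hk) i (le_of_max_le_left hi)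
  have h2 := hM l (le_of_max_le_right hl) j (le_of_max_le_right hj)
  exact hδ.gromovProduct_le hkl.le (by linarith) (by linarith)

/-- A sequence whose points come close to the limit of `s` converges at infinity to that
limit. -/
theorem FourPoint.productTendsToInfinity_of_eventually {δ : ℝ} (hδ : FourPoint S δ) (o : S)
    {s x : ℕ → S} (hs : ProductTendsToInfinity s s)
    (h : ∀ b : ℝ, ∀ᶠ n in atTop, ∀ᶠ i in atTop, b ≤ gromovProduct o (s i) (x n)) :
    ProductTendsToInfinity x s := by
  rw [productTendsToInfinity_iff o] at hs ⊢
  intro b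
  obtain ⟨N, hN⟩ := hs (b + δ)
  obtain ⟨M, hM⟩ := eventually_atTop.1 (h (b + δ))
  refine ⟨max N M, fun n hn i hi => ?_⟩
  obtain ⟨j, hj, hjN⟩ := ((hM n (le_of_max_le_right hn)).and (eventually_ge_atTop N)).exists
  have h1 := hN j hjN i (le_of_max_le_left hi)
  rw [gromovProduct_comm] at hj
  have h2 := hδ (x n) (s i) (s j) o
  have h3 := le_min hj h1
  linarith

end Products

/-! ### Isometries fixing boundary points -/

section Fixed

variable {G : Type u} [Group G] {S : Type v} [MetricSpace S] [MulAction G S] [IsIsometricSMul G S]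

theorem FourPoint.eventually_gromovProduct_smul_le {δ K : ℝ} (hδ : FourPoint S δ) {s : S}
    {x y : ℕ → S} {N : ℕ} (hK : ∀ i ≥ N, ∀ j ≥ N, gromovProduct s (x i) (y j) ≤ K) {g : G}
    (hx : ProductTendsToInfinity (fun i => g • x i) x)
    (hy : ProductTendsToInfinity (fun i => g • y i) y) :
    ∀ᶠ i in atTop, gromovProduct (g • s) (x i) (y i) ≤ K + 2 * δ := by
  rw [productTendsToInfinity_iff (g • s)] at hx hy
  obtain ⟨M, hM⟩ := hx (K + 2 * δ + 1)
  obtain ⟨L, hL⟩ := hy (K + 2 * δ + 1)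
  refine eventually_atTop.2 ⟨max N (max M L), fun i hi => ?_⟩
  simp only [max_le_iff] at hi
  have h1 := hK i hi.1 i hi.1
  have h2 := hM i hi.2.1 i hi.2.1
  have h3 := hL i hi.2.2 i hi.2.2
  rw [← gromovProduct_smul g] at h1
  exact hδ.gromovProduct_le h1 (by linarith) (by linarith)

/-- The bound on the Gromov products of two sequences holds, with the same constant, at all images
of `s` under isometries that fix both limits. -/
theorem FourPoint.exists_eventually_le {δ : ℝ} (hδ : FourPoint S δ) (s : S) {x y : ℕ → S}
    (hx : ProductTendsToInfinity x x) (hy : ProductTendsToInfinity y y)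
    (hxy : ¬ ProductTendsToInfinity x y) :
    ∃ K : ℝ, (∀ᶠ i in atTop, gromovProduct s (x i) (y i) ≤ K) ∧
      ∀ g : G, ProductTendsToInfinity (fun i => g • x i) x →
        ProductTendsToInfinity (fun i => g • y i) y →
        ∀ᶠ i in atTop, gromovProduct (g • s) (x i) (y i) ≤ K := by
  obtain ⟨K, N, hK⟩ := hδ.exists_gromovProduct_le s hx hy hxy
  refine ⟨K + 2 * δ, ?_, fun g gx gy => hδ.eventually_gromovProduct_smul_le hK gx gy⟩
  have h0 := hδ.nonneg s
  exact eventually_atTop.2 ⟨N, fun i hi => (hK i hi i hi).trans (by linarith)⟩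

theorem ProductTendsToInfinity.smul_limit_eq_iff [HyperbolicSpace S] {x : ℕ → S}
    (hx : ProductTendsToInfinity x x) (g : G) :
    g • hx.limit = hx.limit ↔ ProductTendsToInfinity (fun i => g • x i) x :=
  Quotient.eq

theorem fourPoint_exists (S : Type v) [MetricSpace S] [HyperbolicSpace S] :
    ∃ δ : ℝ, FourPoint S δ :=
  HyperbolicSpace.hyperbolic

/-- Isometries that fix three points of the boundary move a given point a bounded distance. -/
theorem exists_dist_smul_le_of_fixes_three [HyperbolicSpace S] {a b c : Boundary S}
    (hab : a ≠ b) (hac : a ≠ c) (hbc : b ≠ c) (s : S) :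
    ∃ C : ℝ, ∀ g : G, g • a = a → g • b = b → g • c = c → dist s (g • s) ≤ C := by
  obtain ⟨δ, hδ⟩ := fourPoint_exists S
  obtain ⟨x, rfl⟩ := exists_limit_eq a
  obtain ⟨y, rfl⟩ := exists_limit_eq b
  obtain ⟨z, rfl⟩ := exists_limit_eq c
  rw [Ne, limit_eq_limit_iff] at hab hac hbc
  obtain ⟨K₁, h₁, h₁'⟩ := hδ.exists_eventually_le (G := G) s x.2 y.2 hab
  obtain ⟨K₂, h₂, h₂'⟩ := hδ.exists_eventually_le (G := G) s x.2 z.2 hac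
  obtain ⟨K₃, h₃, h₃'⟩ := hδ.exists_eventually_le (G := G) s y.2 z.2 hbc
  set K := max K₁ (max K₂ K₃)
  have l₁ : K₁ ≤ K := le_max_left _ _
  have l₂ : K₂ ≤ K := (le_max_left _ _).trans (le_max_right _ _)
  have l₃ : K₃ ≤ K := (le_max_right _ _).trans (le_max_right _ _)
  refine ⟨2 * K + 2 * δ, fun g ga gb gc => ?_⟩
  rw [← limit_smul, limit_eq_limit_iff] at ga gb gc
  obtain ⟨i, e₁, e₂, e₃, e₄, e₅, e₆⟩ := (h₁.and (h₂.and (h₃.and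
    ((h₁' g ga gb).and ((h₂' g ga gc).and (h₃' g gb gc)))))).exists
  exact hδ.dist_le_of_gromovProduct_le (e₁.trans l₁) (e₂.trans l₂) (e₃.trans l₃)
    (e₄.trans l₁) (e₅.trans l₂) (e₆.trans l₃)

/-- If `f` fixes the limit of `x` and moves `s` towards it by a definite amount, then the powers
of `f` move `s` to that limit: the steps add up along the Busemann function of the limit. -/
theorem FourPoint.productTendsToInfinity_pow {δ : ℝ} (hδ : FourPoint S δ) {f : G} {s : S}
    {x w : ℕ → S} (hx : ProductTendsToInfinity x x)
    (hfx : ProductTendsToInfinity (fun i => f⁻¹ • x i) x) (hw : ProductTendsToInfinity w x)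
    (hstep : ∃ᶠ i in atTop, dist (f • s) (w i) - dist s (w i) ≤ -1 - 4 * δ) :
    ProductTendsToInfinity (fun k : ℕ => f ^ k • s) x := by
  have step : ∀ᶠ i in atTop, dist (f • s) (x i) - dist s (x i) ≤ -1 - 2 * δ := by
    obtain ⟨N, hN⟩ := (productTendsToInfinity_iff s).1 hw (dist s (f • s))
    obtain ⟨j, hj, hjN⟩ := (hstep.and_eventually (eventually_ge_atTop N)).exists
    filter_upwards [eventually_ge_atTop N] with i hi
    linarith [hδ.dist_sub_dist_le (hN j hjN i hi)]
  have steps : ∀ k : ℕ, ∀ᶠ i in atTop, dist (f ^ k • s) (x i) - dist s (x i) ≤ -k := by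
    intro k
    induction k with
    | zero => simp
    | succ k ih =>
      obtain ⟨N, hN⟩ := (productTendsToInfinity_iff s).1 hfx.symm (dist s (f ^ k • s))
      obtain ⟨j, hj, hjN⟩ := (ih.and (eventually_ge_atTop N)).exists
      filter_upwards [step, eventually_ge_atTop N] with i h1 hi
      have h2 := hδ.dist_sub_dist_le (hN j hjN i hi)
      rw [← dist_smul f (f ^ k • s) (f⁻¹ • x i), ← dist_smul f s (f⁻¹ • x i), smul_inv_smul,
        smul_smul, ← pow_succ'] at h2
      push_cast
      linarith
  refine hδ.productTendsToInfinity_of_eventually s hx fun b => ?_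
  filter_upwards [tendsto_natCast_atTop_atTop.eventually_ge_atTop b] with k hk
  filter_upwards [steps k] with i hi
  rw [gromovProduct_comm]
  have h1 := dist_sub_dist_eq s (f ^ k • s) (x i)
  have h2 := dist_triangle s (f ^ k • s) (x i)
  linarith

/-- An element with unbounded cyclic orbits that fixes two boundary points `a` and `b` has a power
whose positive iterates converge to `a` and whose negative iterates converge to `b`. -/
theorem exists_mem_zpowers_productTendsToInfinity [HyperbolicSpace S] {g : G} {s : S}
    (hg : ¬ Bornology.IsBounded (MulAction.orbit (Subgroup.zpowers g) s)) {x y : SeqAtInfinity S}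
    (hxy : x.limit ≠ y.limit) (hx : ∀ h ∈ Subgroup.zpowers g, h • x.limit = x.limit)
    (hy : ∀ h ∈ Subgroup.zpowers g, h • y.limit = y.limit) :
    ∃ f ∈ Subgroup.zpowers g, ProductTendsToInfinity (fun k : ℕ => f ^ k • s) x.1 ∧
      ProductTendsToInfinity (fun k : ℕ => f⁻¹ ^ k • s) y.1 := by
  obtain ⟨δ, hδ⟩ := fourPoint_exists S
  rw [Ne, limit_eq_limit_iff] at hxy
  have fix : ∀ z : SeqAtInfinity S, (∀ h ∈ Subgroup.zpowers g, h • z.limit = z.limit) →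
      ∀ h ∈ Subgroup.zpowers g, ProductTendsToInfinity (fun i => h • z.1 i) z.1 := by
    intro z hz h hh
    have := hz h hh
    rwa [← limit_smul, limit_eq_limit_iff] at this
  replace hx := fix x hx
  replace hy := fix y hy
  obtain ⟨K, hK, hK'⟩ := hδ.exists_eventually_le (G := G) s x.2 y.2 hxy
  -- A power that moves `s` so far that the displacement exceeds all errors in the comparison of
  -- directions below.
  obtain ⟨f, hf, hfar⟩ : ∃ f ∈ Subgroup.zpowers g,
      max 0 (2 * K + 2 * δ) + 1 + 4 * δ < dist s (f • s) := by
    by_contra! hc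
    refine hg ((Metric.isBounded_closedBall (x := s)
      (r := max 0 (2 * K + 2 * δ) + 1 + 4 * δ)).subset ?_)
    rintro _ ⟨⟨f, hf⟩, rfl⟩
    rw [Metric.mem_closedBall, dist_comm]
    exact hc f hf
  have hfar' : 2 * K + 2 * δ + 1 + 4 * δ < dist s (f • s) := by
    linarith [le_max_right 0 (2 * K + 2 * δ)]
  have hf' : f⁻¹ ∈ Subgroup.zpowers g := inv_mem hf
  -- Seen from `s`, the point `f • s` lies either in the direction of the limit of `x` or in the
  -- direction of the limit of `y`.
  have key : ∀ᶠ i in atTop,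
      (dist (f • s) (x.1 i) - dist s (x.1 i) ≤ -1 - 4 * δ ∧
        dist (f⁻¹ • s) (f⁻¹ • y.1 i) - dist s (f⁻¹ • y.1 i) ≤ -1 - 4 * δ) ∨
      (dist (f • s) (y.1 i) - dist s (y.1 i) ≤ -1 - 4 * δ ∧
        dist (f⁻¹ • s) (f⁻¹ • x.1 i) - dist s (f⁻¹ • x.1 i) ≤ -1 - 4 * δ) := by
    filter_upwards [hK, hK' f (hx f hf) (hy f hf)] with i h1 h2
    have e : ∀ z : S, dist (f⁻¹ • s) (f⁻¹ • z) - dist s (f⁻¹ • z) =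
        -(dist (f • s) z - dist s z) := by
      intro z
      rw [dist_smul, ← dist_smul f s (f⁻¹ • z), smul_inv_smul]
      ring
    rw [e, e]
    have i1 := (hδ (x.1 i) (y.1 i) (f • s) s).trans h1
    have i2 := (hδ (x.1 i) (y.1 i) s (f • s)).trans h2
    rw [gromovProduct_comm _ (x.1 i)] at i1 i2
    have j1 := dist_sub_dist_eq s (f • s) (x.1 i)
    have j2 := dist_sub_dist_eq s (f • s) (y.1 i)
    have k1 := gromovProduct_add_swap s (f • s) (x.1 i)
    have k2 := gromovProduct_add_swap s (f • s) (y.1 i)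
    rcases min_le_iff.1 (sub_le_iff_le_add.1 i1) with a1 | a1 <;>
      rcases min_le_iff.1 (sub_le_iff_le_add.1 i2) with a2 | a2
    · linarith [hδ.nonneg s]
    · right
      constructor <;> linarith
    · left
      constructor <;> linarith
    · linarith [hδ.nonneg s]
  rcases frequently_or_distrib.1 key.frequently with h | h
  · exact ⟨f, hf, hδ.productTendsToInfinity_pow x.2 (hx _ hf') x.2 (h.mono fun i hi => hi.1),
      hδ.productTendsToInfinity_pow y.2 (hy _ (inv_mem hf')) (hy _ hf')
        (h.mono fun i hi => hi.2)⟩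
  · refine ⟨f⁻¹, hf', hδ.productTendsToInfinity_pow x.2 (hx _ (inv_mem hf')) (hx _ hf')
      (h.mono fun i hi => hi.2), ?_⟩
    refine hδ.productTendsToInfinity_pow y.2 (hy _ (inv_mem (inv_mem hf'))) y.2
      (h.mono fun i hi => ?_)
    rw [inv_inv]
    exact hi.1

end Fixed

/-! ### Neighbourhoods of boundary points and limit sets -/

section Closure

variable {S : Type v} [MetricSpace S] [HyperbolicSpace S]

theorem eventually_lt_of_point_mem_basicNhd {o x : S} {a : Boundary S} {r : ℝ}
    (h : .point x ∈ basicNhd o a r) {s : SeqAtInfinity S} (hs : s.limit = a) :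
    ∀ᶠ i in atTop, r < gromovProduct o (s.1 i) x := by
  have h1 : (r : EReal) < extProduct o a (.point x) := h
  have h2 := lt_of_lt_of_le h1 (iInf_le _ ⟨s, hs⟩)
  filter_upwards [eventually_lt_of_lt_liminf h2] with i hi
  exact EReal.coe_lt_coe_iff.1 hi

theorem point_mem_basicNhd {o x : S} {a : Boundary S} {r R : ℝ} (hr : r < R)
    (h : ∀ s : SeqAtInfinity S, s.limit = a → ∀ᶠ i in atTop, R ≤ gromovProduct o (s.1 i) x) :
    .point x ∈ basicNhd o a r := by
  refine lt_of_lt_of_le (EReal.coe_lt_coe_iff.2 hr) (le_iInf fun s => ?_)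
  refine le_liminf_of_le (by isBoundedDefault) ?_
  filter_upwards [h s.1 s.2] with i hi
  exact EReal.coe_le_coe_iff.2 hi

theorem eventually_lt_of_ideal_mem_basicNhd {o : S} {a b : Boundary S} {r : ℝ}
    (h : .ideal b ∈ basicNhd o a r) {s t : SeqAtInfinity S} (hs : s.limit = a)
    (ht : t.limit = b) : ∀ᶠ p : ℕ × ℕ in atTop, r < gromovProduct o (s.1 p.1) (t.1 p.2) := by
  have h1 : (r : EReal) < extProduct o a (.ideal b) := h
  have h2 := lt_of_lt_of_le h1 ((iInf_le _ ⟨s, hs⟩).trans (iInf_le _ ⟨t, ht⟩))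
  filter_upwards [eventually_lt_of_lt_liminf h2] with i hi
  exact EReal.coe_lt_coe_iff.1 hi

theorem ideal_mem_basicNhd {o : S} {a b : Boundary S} {r R : ℝ} (hr : r < R)
    (h : ∀ s t : SeqAtInfinity S, s.limit = a → t.limit = b →
      ∀ᶠ p : ℕ × ℕ in atTop, R ≤ gromovProduct o (s.1 p.1) (t.1 p.2)) :
    .ideal b ∈ basicNhd o a r := by
  refine lt_of_lt_of_le (EReal.coe_lt_coe_iff.2 hr) (le_iInf fun s => le_iInf fun t => ?_)
  refine le_liminf_of_le (by isBoundedDefault) ?_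
  filter_upwards [h s.1 t.1 s.2 t.2] with i hi
  exact EReal.coe_le_coe_iff.2 hi

theorem basicNhd_anti {o : S} {a : Boundary S} {r r' : ℝ} (h : r ≤ r') :
    basicNhd o a r' ⊆ basicNhd o a r :=
  fun _ hp => lt_of_le_of_lt (EReal.coe_le_coe_iff.2 h) hp

theorem basicNhd_subset_of_basepoint (o o' : S) (a : Boundary S) (r : ℝ) :
    basicNhd o' a (r + 1 + dist o o') ⊆ basicNhd o a r := by
  rintro (x | b) hp
  · refine point_mem_basicNhd (lt_add_one r) fun s hs => ?_
    filter_upwards [eventually_lt_of_point_mem_basicNhd hp hs] with i hi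
    linarith [gromovProduct_le_add_dist o o' (s.1 i) x]
  · refine ideal_mem_basicNhd (lt_add_one r) fun s t hs ht => ?_
    filter_upwards [eventually_lt_of_ideal_mem_basicNhd hp hs ht] with i hi
    linarith [gromovProduct_le_add_dist o o' (s.1 i.1) (t.1 i.2)]

theorem isOpen_setOf_point_mem_basicNhd (o : S) (a : Boundary S) (r : ℝ) :
    IsOpen {x : S | .point x ∈ basicNhd o a r} := by
  rw [Metric.isOpen_iff]
  intro x hx
  obtain ⟨R, hrR, hR⟩ := EReal.lt_iff_exists_real_btwn.1 (show (r : EReal) < _ from hx)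
  rw [EReal.coe_lt_coe_iff] at hrR
  refine ⟨(R - r) / 2, by linarith, fun y hy => ?_⟩
  rw [Metric.mem_ball] at hy
  refine point_mem_basicNhd (show r < (R + r) / 2 by linarith) fun s hs => ?_
  filter_upwards [eventually_lt_of_point_mem_basicNhd (r := R) hR hs] with i hi
  linarith [gromovProduct_le_add_dist_right o (s.1 i) y x]

/-- Hyperbolicity, extended to the boundary. -/
theorem FourPoint.basicNhd_subset {δ : ℝ} (hδ : FourPoint S δ) {o : S} {b c : Boundary S} {r : ℝ}
    (hc : .ideal c ∈ basicNhd o b (r + δ + 1)) :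
    basicNhd o c (r + δ + 1) ⊆ basicNhd o b r := by
  obtain ⟨t, ht⟩ := exists_limit_eq c
  rintro (x | d) hp
  · refine point_mem_basicNhd (lt_add_one r) fun s hs => ?_
    obtain ⟨N, hN⟩ := eventually_atTop.1 (eventually_lt_of_ideal_mem_basicNhd hc hs ht)
    obtain ⟨j, hj, hjN⟩ := ((eventually_lt_of_point_mem_basicNhd hp ht).and
      (eventually_ge_atTop N.2)).exists
    filter_upwards [eventually_ge_atTop N.1] with i hi
    have h1 := hN (i, j) ⟨hi, hjN⟩
    have h2 := hδ (s.1 i) x (t.1 j) o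
    have h3 := lt_min h1 hj
    linarith
  · refine ideal_mem_basicNhd (lt_add_one r) fun s u hs hu => ?_
    obtain ⟨N, hN⟩ := eventually_atTop.1 (eventually_lt_of_ideal_mem_basicNhd hc hs ht)
    obtain ⟨M, hM⟩ := eventually_atTop.1 (eventually_lt_of_ideal_mem_basicNhd hp ht hu)
    refine eventually_atTop.2 ⟨(N.1, M.2), fun p hp => ?_⟩
    have h1 := hN (p.1, max N.2 M.1) ⟨hp.1, le_max_left _ _⟩
    have h2 := hM (max N.2 M.1, p.2) ⟨le_max_right _ _, hp.2⟩
    have h3 := hδ (s.1 p.1) (u.1 p.2) (t.1 (max N.2 M.1)) o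
    have h4 := lt_min h1 h2
    simp only at h4
    linarith

/-- The sets `basicNhd o a r` are neighbourhoods of `a`, although they need not be open: the
points of `S` in `basicNhd o a r` together with the boundary points that have a basic
neighbourhood inside it form an open set. -/
theorem exists_mem_basicNhd_of_mem_closure {A : Set S} {a : Boundary S}
    (ha : .ideal a ∈ closure (Bordification.point '' A)) (o : S) (r : ℝ) :
    ∃ x ∈ A, .point x ∈ basicNhd o a r := by
  obtain ⟨δ, hδ⟩ := fourPoint_exists S
  let V : Set (Bordification S) := {p | match p with
    | .point x => .point x ∈ basicNhd o a r
    | .ideal b => ∃ r', basicNhd o b r' ⊆ basicNhd o a r}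
  have hV : IsOpen V := by
    refine ⟨isOpen_setOf_point_mem_basicNhd o a r, ?_⟩
    rintro b ⟨r', hb⟩ o'
    refine ⟨r' + δ + 1 + 1 + dist o o', fun p hp => ?_⟩
    have hp' := basicNhd_subset_of_basepoint o o' b _ hp
    cases p with
    | point x =>
      have := hδ.nonneg o
      exact hb (basicNhd_anti (by linarith) hp')
    | ideal c => exact ⟨_, (hδ.basicNhd_subset hp').trans hb⟩
  obtain ⟨_, hxV, x, hx, rfl⟩ := mem_closure_iff.1 ha V hV ⟨r, subset_rfl⟩
  exact ⟨x, hx, hxV⟩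

theorem SeqAtInfinity.ideal_limit_mem_closure (x : SeqAtInfinity S) {A : Set S}
    (hx : ∀ n, x.1 n ∈ A) : .ideal x.limit ∈ closure (Bordification.point '' A) := by
  obtain ⟨δ, hδ⟩ := fourPoint_exists S
  refine mem_closure_iff.2 fun U hU hxU => ?_
  obtain ⟨r, hr⟩ := hU.2 x.limit hxU (x.1 0)
  obtain ⟨N, hN⟩ := (productTendsToInfinity_iff (x.1 0)).1 x.2 (r + 1 + δ)
  refine ⟨.point (x.1 N), hr (point_mem_basicNhd (lt_add_one r) fun s hs => ?_), x.1 N, hx N, rfl⟩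
  obtain ⟨M, hM⟩ := (productTendsToInfinity_iff (x.1 0)).1 (limit_eq_limit_iff.1 hs) (r + 1 + δ)
  filter_upwards [eventually_ge_atTop M] with i hi
  have h1 := hM i hi (max M N) (le_max_left _ _)
  have h2 := hN (max M N) (le_max_right _ _) N le_rfl
  have h3 := hδ (s.1 i) (x.1 N) (x.1 (max M N)) (x.1 0)
  have h4 := le_min h1 h2
  linarith

end Closure

section LimitSet

variable {G : Type u} [Group G] {S : Type v} [MetricSpace S] [HyperbolicSpace S] [MulAction G S]

theorem limit_mem_limitSet [IsIsometricSMul G S] {s : S} (g : ℕ → G)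
    (h : ProductTendsToInfinity (fun n => g n • s) (fun n => g n • s)) :
    h.limit ∈ limitSet G S := by
  intro t
  have hd : ∀ n, dist (g n • s) (g n • t) ≤ dist s t := fun n => (dist_smul _ _ _).le
  have h1 := h.of_dist_le hd
  let y : SeqAtInfinity S := ⟨fun n => g n • t, h1.symm.of_dist_le hd⟩
  have h2 : h.limit = y.limit := h.limit_eq_seq_limit_iff.2 h1.symm
  rw [h2]
  exact y.ideal_limit_mem_closure fun n => ⟨g n, rfl⟩

theorem exists_limit_eq_of_mem_limitSet {a : Boundary S} (ha : a ∈ limitSet G S) (s : S) :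
    ∃ (g : ℕ → G) (h : ProductTendsToInfinity (fun n => g n • s) (fun n => g n • s)),
      h.limit = a := by
  obtain ⟨δ, hδ⟩ := fourPoint_exists S
  have h1 : ∀ n : ℕ, ∃ g : G, .point (g • s) ∈ basicNhd s a n := by
    intro n
    obtain ⟨_, ⟨g, rfl⟩, hg⟩ := exists_mem_basicNhd_of_mem_closure (ha s) s n
    exact ⟨g, hg⟩
  choose g hg using h1
  obtain ⟨x, hx⟩ := exists_limit_eq a
  have h2 : ProductTendsToInfinity (fun n => g n • s) x.1 := by
    refine hδ.productTendsToInfinity_of_eventually s x.2 fun b => ?_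
    filter_upwards [tendsto_natCast_atTop_atTop.eventually_ge_atTop b] with n hn
    filter_upwards [eventually_lt_of_point_mem_basicNhd (hg n) hx] with i hi
    exact hn.trans hi.le
  exact ⟨g, h2.trans h2.symm, (ProductTendsToInfinity.limit_eq_seq_limit_iff _).2 h2 |>.trans hx⟩

end LimitSet

/-! ### The injective hull of a pseudometric space -/

section Hull

variable {Y : Type v} [PseudoMetricSpace Y]

/-- The functions `f` with `d(x, y) ≤ f(x) + f(y)`: candidates for the distances of the points of
`Y` from an additional point. -/
def IsDistanceLike (f : Y → ℝ) : Prop :=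
  ∀ x y, dist x y ≤ f x + f y

/-- The extremal functions on `Y`: the pointwise minimal distance-like ones. Minimality is
expressed as `f(x) = sup_y (d(x, y) - f(y))`. -/
def IsExtremal (f : Y → ℝ) : Prop :=
  ∀ x, IsLUB (Set.range fun y => dist x y - f y) (f x)

theorem IsExtremal.isDistanceLike {f : Y → ℝ} (hf : IsExtremal f) : IsDistanceLike f := by
  intro x y
  have := (hf x).1 ⟨y, rfl⟩
  simp only at this
  linarith

theorem IsExtremal.le_add_dist {f : Y → ℝ} (hf : IsExtremal f) (x y : Y) :
    f x ≤ f y + dist x y := by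
  refine (hf x).2 ?_
  rintro _ ⟨z, rfl⟩
  have h1 := hf.isDistanceLike y z
  have h2 := dist_triangle x y z
  simp only
  linarith

theorem IsExtremal.eq_of_dist_eq_zero {f : Y → ℝ} (hf : IsExtremal f) {x y : Y}
    (h : dist x y = 0) : f x = f y := by
  have h1 := hf.le_add_dist x y
  have h2 := hf.le_add_dist y x
  rw [dist_comm] at h2
  linarith

theorem isExtremal_dist (z : Y) : IsExtremal fun x => dist x z := by
  intro x
  constructor
  · rintro _ ⟨y, rfl⟩
    simp only
    linarith [dist_triangle_right x y z]
  · intro b hb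
    have := hb ⟨z, rfl⟩
    simpa using this

theorem IsDistanceLike.nonneg {f : Y → ℝ} (hf : IsDistanceLike f) (x : Y) : 0 ≤ f x := by
  have := hf x x
  rw [dist_self] at this
  linarith

theorem IsExtremal.sub_le {f g : Y → ℝ} (hf : IsExtremal f) (hg : IsExtremal g) (x y : Y) :
    f x - g x ≤ f y + g y := by
  have h1 := hf.le_add_dist x y
  have h2 := hg.isDistanceLike x y
  linarith

variable (Y) in
/-- The injective hull (or tight span) of `Y`, with the supremum metric. -/
def InjectiveHull : Type v :=
  {f : Y → ℝ // IsExtremal f}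

theorem InjectiveHull.abs_sub_le (f g : InjectiveHull Y) (x y : Y) :
    |f.1 x - g.1 x| ≤ f.1 y + g.1 y := by
  rw [abs_sub_le_iff]
  refine ⟨f.2.sub_le g.2 x y, ?_⟩
  rw [add_comm]
  exact g.2.sub_le f.2 x y

theorem InjectiveHull.bddAbove (f g : InjectiveHull Y) :
    BddAbove (Set.range fun x => |f.1 x - g.1 x|) := by
  rcases isEmpty_or_nonempty Y with h | ⟨⟨y⟩⟩
  · rw [Set.range_eq_empty]
    exact bddAbove_empty
  · refine ⟨f.1 y + g.1 y, ?_⟩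
    rintro _ ⟨x, rfl⟩
    exact f.abs_sub_le g x y

noncomputable instance : MetricSpace (InjectiveHull Y) where
  dist f g := ⨆ x, |f.1 x - g.1 x|
  dist_self f := by simp
  dist_comm f g := by simp only [abs_sub_comm]
  dist_triangle f g h := by
    refine Real.iSup_le (fun x => ?_)
      (add_nonneg (Real.iSup_nonneg fun _ => abs_nonneg _) (Real.iSup_nonneg fun _ => abs_nonneg _))
    exact (_root_.abs_sub_le _ _ _).trans (add_le_add (le_ciSup (f.bddAbove g) x)
      (le_ciSup (g.bddAbove h) x))
  eq_of_dist_eq_zero {f g} h := by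
    refine Subtype.ext (funext fun x => ?_)
    have h1 := le_ciSup (f.bddAbove g) x
    have h2 : (⨆ x, |f.1 x - g.1 x|) = 0 := h
    rw [h2] at h1
    exact sub_eq_zero.1 (abs_nonpos_iff.1 h1)

theorem InjectiveHull.abs_sub_le_dist (f g : InjectiveHull Y) (x : Y) :
    |f.1 x - g.1 x| ≤ dist f g :=
  le_ciSup (f.bddAbove g) x

theorem InjectiveHull.dist_le {f g : InjectiveHull Y} {r : ℝ} (hr : 0 ≤ r)
    (h : ∀ x, |f.1 x - g.1 x| ≤ r) : dist f g ≤ r :=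
  Real.iSup_le h hr

/-- The canonical map of `Y` to its injective hull. -/
def InjectiveHull.of (y : Y) : InjectiveHull Y :=
  ⟨fun x => dist x y, isExtremal_dist y⟩

theorem InjectiveHull.dist_of_of (y z : Y) : dist (of y) (of z) = dist y z := by
  apply le_antisymm
  · refine dist_le dist_nonneg fun x => ?_
    have := abs_dist_sub_le y z x
    rwa [dist_comm y x, dist_comm z x] at this
  · have := abs_sub_le_dist (of y) (of z) y
    simpa [of] using this

/-! ### The injective hull is geodesic -/

/-- The operation `f ↦ (f + f*) / 2`, where `f*(x) = sup_y (d(x, y) - f(y))`. -/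
noncomputable def hullStep (f : Y → ℝ) (x : Y) : ℝ :=
  (f x + ⨆ y, (dist x y - f y)) / 2

theorem IsDistanceLike.bddAbove {f : Y → ℝ} (hf : IsDistanceLike f) (x : Y) :
    BddAbove (Set.range fun y => dist x y - f y) := by
  refine ⟨f x, ?_⟩
  rintro _ ⟨y, rfl⟩
  simp only
  linarith [hf x y]

theorem IsDistanceLike.iSup_le {f : Y → ℝ} (hf : IsDistanceLike f) (x : Y) :
    ⨆ y, (dist x y - f y) ≤ f x := by
  have : Nonempty Y := ⟨x⟩
  exact ciSup_le fun y => by linarith [hf x y]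

theorem IsDistanceLike.hullStep_le {f : Y → ℝ} (hf : IsDistanceLike f) (x : Y) :
    hullStep f x ≤ f x := by
  unfold hullStep
  linarith [hf.iSup_le x]

theorem IsDistanceLike.isDistanceLike_hullStep {f : Y → ℝ} (hf : IsDistanceLike f) :
    IsDistanceLike (hullStep f) := by
  intro x y
  have h1 := le_ciSup (hf.bddAbove x) y
  have h2 := le_ciSup (hf.bddAbove y) x
  rw [dist_comm y x] at h2
  unfold hullStep
  linarith

theorem hullStep_le_add {f g : Y → ℝ} (hg : IsDistanceLike g) {r : ℝ}
    (h : ∀ x, |f x - g x| ≤ r) (x : Y) : hullStep f x ≤ hullStep g x + r := by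
  have : Nonempty Y := ⟨x⟩
  have h1 : ⨆ y, (dist x y - f y) ≤ (⨆ y, (dist x y - g y)) + r := by
    refine ciSup_le fun y => ?_
    have h1 := le_ciSup (hg.bddAbove x) y
    have h2 := (abs_le.1 (h y)).1
    linarith
  have h2 := (abs_le.1 (h x)).2
  unfold hullStep
  linarith

theorem IsExtremal.hullStep_eq {f : Y → ℝ} (hf : IsExtremal f) : hullStep f = f := by
  funext x
  have : Nonempty Y := ⟨x⟩
  unfold hullStep
  have h := (hf x).csSup_eq (Set.range_nonempty _)
  rw [← sSup_range, h]
  ring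

theorem IsDistanceLike.iterate {f : Y → ℝ} (hf : IsDistanceLike f) (n : ℕ) :
    IsDistanceLike (hullStep^[n] f) := by
  induction n with
  | zero => exact hf
  | succ n ih =>
    rw [Function.iterate_succ_apply']
    exact ih.isDistanceLike_hullStep

theorem IsDistanceLike.antitone_iterate {f : Y → ℝ} (hf : IsDistanceLike f) (x : Y) :
    Antitone fun n => hullStep^[n] f x := by
  refine antitone_nat_of_succ_le fun n => ?_
  rw [Function.iterate_succ_apply']
  exact (hf.iterate n).hullStep_le x

/-- The retraction of the distance-like functions to the extremal ones: the pointwise limit of the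
iterates of `hullStep`. -/
noncomputable def hullRetraction (f : Y → ℝ) (x : Y) : ℝ :=
  ⨅ n : ℕ, hullStep^[n] f x

theorem IsDistanceLike.tendsto_hullRetraction {f : Y → ℝ} (hf : IsDistanceLike f) (x : Y) :
    Tendsto (fun n => hullStep^[n] f x) atTop (𝓝 (hullRetraction f x)) := by
  refine tendsto_atTop_ciInf (hf.antitone_iterate x) ⟨0, ?_⟩
  rintro _ ⟨n, rfl⟩
  exact (hf.iterate n).nonneg x

theorem IsDistanceLike.isExtremal_hullRetraction {f : Y → ℝ} (hf : IsDistanceLike f) :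
    IsExtremal (hullRetraction f) := by
  have hd : IsDistanceLike (hullRetraction f) := fun x y =>
    ge_of_tendsto' ((hf.tendsto_hullRetraction x).add (hf.tendsto_hullRetraction y))
      fun n => hf.iterate n x y
  intro x
  have : Nonempty Y := ⟨x⟩
  constructor
  · rintro _ ⟨y, rfl⟩
    simp only
    linarith [hd x y]
  · intro b hb
    -- Writing `fₙ` for the iterates, `fₙ* = 2 fₙ₊₁ - fₙ` tends to the limit of `fₙ`, and it is
    -- bounded above by `b` because the iterates decrease.
    have h1 : ∀ n, 2 * hullStep^[n + 1] f x - hullStep^[n] f x ≤ b := by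
      intro n
      have h2 : ⨆ y, (dist x y - hullStep^[n] f y) ≤ b := by
        refine ciSup_le fun y => le_trans ?_ (hb ⟨y, rfl⟩)
        have := (hf.antitone_iterate y).le_of_tendsto (hf.tendsto_hullRetraction y) n
        simp only
        linarith
      rw [Function.iterate_succ_apply']
      have h3 : hullStep (hullStep^[n] f) x =
        (hullStep^[n] f x + ⨆ y, (dist x y - hullStep^[n] f y)) / 2 := rfl
      linarith
    have h2 := hf.tendsto_hullRetraction x
    have h3 := le_of_tendsto' ((((tendsto_add_atTop_iff_nat 1).2 h2).const_mul 2).sub h2) h1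
    linarith

theorem abs_hullRetraction_sub_le {f g : Y → ℝ} (hf : IsDistanceLike f) (hg : IsDistanceLike g)
    {r : ℝ} (h : ∀ x, |f x - g x| ≤ r) (x : Y) :
    |hullRetraction f x - hullRetraction g x| ≤ r := by
  have h1 : ∀ n x, |hullStep^[n] f x - hullStep^[n] g x| ≤ r := by
    intro n
    induction n with
    | zero => exact h
    | succ n ih =>
      intro x
      rw [Function.iterate_succ_apply', Function.iterate_succ_apply', abs_sub_le_iff]
      have h2 := hullStep_le_add (hg.iterate n) ih x
      have h3 := hullStep_le_add (hf.iterate n)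
        (fun x => by rw [abs_sub_comm]; exact ih x) x
      constructor <;> linarith
  exact le_of_tendsto' ((hf.tendsto_hullRetraction x).sub (hg.tendsto_hullRetraction x)).abs
    fun n => h1 n x

theorem IsExtremal.hullRetraction_eq {f : Y → ℝ} (hf : IsExtremal f) : hullRetraction f = f := by
  funext x
  unfold hullRetraction
  simp [Function.iterate_fixed hf.hullStep_eq]

/-- A geodesic of the injective hull is the image under the retraction of a straight segment: it
is `1`-Lipschitz, and its length is the distance of its endpoints. -/
theorem isGeodesicSpace_injectiveHull : IsGeodesicSpace (InjectiveHull Y) := by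
  intro f g
  set L := dist f g with hL
  rcases (dist_nonneg : 0 ≤ dist f g).eq_or_lt with h0 | h0
  · refine ⟨fun _ => f, rfl, dist_eq_zero.1 h0.symm, fun s hs t ht => ?_⟩
    rw [hL, ← h0, Set.Icc_self, Set.mem_singleton_iff] at hs ht
    simp [hs, ht]
  rw [← hL] at h0
  -- The segment, with the parameter clamped to the unit interval.
  let τ : ℝ → ℝ := fun t => max 0 (min 1 (t / L))
  have τ0 : ∀ t, 0 ≤ τ t := fun t => le_max_left _ _
  have τ1 : ∀ t, τ t ≤ 1 := fun t => max_le zero_le_one (min_le_left _ _)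
  have τL : ∀ t ∈ Set.Icc 0 L, τ t = t / L := by
    intro t ht
    have h1 : t / L ≤ 1 := (div_le_one h0).2 ht.2
    have h2 : 0 ≤ t / L := div_nonneg ht.1 h0.le
    simp [τ, h1, h2]
  let σ : ℝ → Y → ℝ := fun t x => (1 - τ t) * f.1 x + τ t * g.1 x
  have hσ : ∀ t, IsDistanceLike (σ t) := by
    intro t x y
    have h1 := mul_le_mul_of_nonneg_left (f.2.isDistanceLike x y) (sub_nonneg.2 (τ1 t))
    have h2 := mul_le_mul_of_nonneg_left (g.2.isDistanceLike x y) (τ0 t)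
    simp only [σ]
    linarith
  let γ : ℝ → InjectiveHull Y := fun t => ⟨hullRetraction (σ t), (hσ t).isExtremal_hullRetraction⟩
  have hγ0 : γ 0 = f := by
    refine Subtype.ext ?_
    have h1 : σ 0 = f.1 := by
      funext x
      simp [σ, τL 0 ⟨le_rfl, h0.le⟩]
    change hullRetraction (σ 0) = f.1
    rw [h1, f.2.hullRetraction_eq]
  have hγL : γ L = g := by
    refine Subtype.ext ?_
    have h1 : σ L = g.1 := by
      funext x
      simp [σ, τL L ⟨h0.le, le_rfl⟩, div_self h0.ne']
    change hullRetraction (σ L) = g.1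
    rw [h1, g.2.hullRetraction_eq]
  have lip : ∀ s ∈ Set.Icc 0 L, ∀ t ∈ Set.Icc 0 L, dist (γ s) (γ t) ≤ |s - t| := by
    intro s hs t ht
    refine InjectiveHull.dist_le (abs_nonneg _)
      (abs_hullRetraction_sub_le (hσ s) (hσ t) fun x => ?_)
    have h1 : σ s x - σ t x = (s - t) / L * (g.1 x - f.1 x) := by
      simp only [σ]
      rw [τL s hs, τL t ht]
      ring
    have h2 : |g.1 x - f.1 x| ≤ L := by
      rw [abs_sub_comm]
      exact f.abs_sub_le_dist g x
    rw [h1, abs_mul, abs_div, abs_of_pos h0]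
    calc |s - t| / L * |g.1 x - f.1 x| ≤ |s - t| / L * L :=
          mul_le_mul_of_nonneg_left h2 (div_nonneg (abs_nonneg _) h0.le)
      _ = |s - t| := div_mul_cancel₀ _ h0.ne'
  refine ⟨γ, hγ0, hγL, ?_⟩
  have main : ∀ s ∈ Set.Icc 0 L, ∀ t ∈ Set.Icc 0 L, s ≤ t → dist (γ s) (γ t) = |s - t| := by
    intro s hs t ht hst
    refine le_antisymm (lip s hs t ht) ?_
    have h1 := lip 0 ⟨le_rfl, h0.le⟩ s hs
    have h2 := lip t ht L ⟨h0.le, le_rfl⟩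
    have h3 := dist_triangle4 (γ 0) (γ s) (γ t) (γ L)
    have h4 : dist (γ 0) (γ L) = L := by rw [hγ0, hγL]
    rw [abs_sub_comm, sub_zero, abs_of_nonneg hs.1] at h1
    rw [abs_sub_comm, abs_of_nonneg (sub_nonneg.2 ht.2)] at h2
    rw [abs_sub_comm, abs_of_nonneg (sub_nonneg.2 hst)]
    linarith
  intro s hs t ht
  rcases le_total s t with h | h
  · exact main s hs t ht h
  · rw [dist_comm, abs_sub_comm]
    exact main t ht s hs h

/-! ### The injective hull of a hyperbolic space is hyperbolic -/

theorem InjectiveHull.dist_sub_sub_le (f g : InjectiveHull Y) (x y : Y) :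
    dist x y - f.1 x - g.1 y ≤ dist f g := by
  have h1 := f.2.isDistanceLike x y
  have h2 := (abs_le.1 (f.abs_sub_le_dist g y)).2
  linarith

/-- The distance of two extremal functions `f` and `g` is the supremum of
`d(x, y) - f(x) - g(y)`. -/
theorem InjectiveHull.exists_dist_lt [Nonempty Y] (f g : InjectiveHull Y) {ε : ℝ} (hε : 0 < ε) :
    ∃ x y : Y, dist f g < dist x y - f.1 x - g.1 y + ε := by
  have key : ∀ f g : InjectiveHull Y, ∀ x, ∃ y,
      f.1 x - g.1 x < dist x y - f.1 y - g.1 x + ε / 2 := by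
    intro f g x
    obtain ⟨_, ⟨y, rfl⟩, hy, -⟩ := (f.2 x).exists_between (sub_lt_self (f.1 x) (half_pos hε))
    exact ⟨y, by linarith⟩
  obtain ⟨x, hx⟩ := exists_lt_of_lt_ciSup (show dist f g - ε / 2 < ⨆ x, |f.1 x - g.1 x| from
    sub_lt_self _ (half_pos hε))
  rcases abs_cases (f.1 x - g.1 x) with ⟨h, -⟩ | ⟨h, -⟩
  · obtain ⟨y, hy⟩ := key f g x
    refine ⟨y, x, ?_⟩
    rw [dist_comm y x]
    linarith
  · obtain ⟨y, hy⟩ := key g f x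
    exact ⟨x, y, by linarith⟩

/-- The four-point inequality passes to the hull since distances in the hull are suprema of
`d(x, y) - f(x) - g(y)`, and the subtracted terms are the same in all three sums of distances. -/
theorem injectiveHull_four_point [Nonempty Y] {δ : ℝ}
    (hδ : ∀ x y z w : Y, dist x y + dist z w ≤
      max (dist x z + dist y w) (dist x w + dist y z) + 2 * δ) (f g h k : InjectiveHull Y) :
    dist f g + dist h k ≤ max (dist f h + dist g k) (dist f k + dist g h) + 2 * δ := by
  refine le_of_forall_pos_le_add fun ε hε => ?_
  obtain ⟨x, y, hxy⟩ := f.exists_dist_lt g (half_pos hε)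
  obtain ⟨z, w, hzw⟩ := h.exists_dist_lt k (half_pos hε)
  have h1 := f.dist_sub_sub_le h x z
  have h2 := g.dist_sub_sub_le k y w
  have h3 := f.dist_sub_sub_le k x w
  have h4 := g.dist_sub_sub_le h y z
  have h5 := hδ x y z w
  have h6 := le_max_left (dist f h + dist g k) (dist f k + dist g h)
  have h7 := le_max_right (dist f h + dist g k) (dist f k + dist g h)
  rcases le_total (dist x z + dist y w) (dist x w + dist y z) with h8 | h8
  · rw [max_eq_right h8] at h5
    linarith
  · rw [max_eq_left h8] at h5
    linarith

theorem hyperbolicSpace_injectiveHull [Nonempty Y] {δ : ℝ}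
    (hδ : ∀ x y z w : Y, dist x y + dist z w ≤
      max (dist x z + dist y w) (dist x w + dist y z) + 2 * δ) :
    HyperbolicSpace (InjectiveHull Y) where
  geodesic := isGeodesicSpace_injectiveHull
  hyperbolic := by
    refine ⟨δ, fun x y z o => ?_⟩
    have h := injectiveHull_four_point hδ x y z o
    unfold gromovProduct
    rw [sub_le_iff_le_add, min_le_iff]
    rw [← sub_le_iff_le_add, le_max_iff] at h
    rcases h with h | h
    · left
      linarith
    · right
      rw [dist_comm z y]
      linarith

/-! ### Group actions on the injective hull -/

variable {G : Type u} [Group G] [MulAction G Y] [IsIsometricSMul G Y]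

theorem IsExtremal.comp_smul {f : Y → ℝ} (hf : IsExtremal f) (g : G) :
    IsExtremal fun x => f (g • x) := by
  intro x
  have h : (Set.range fun y => dist x y - f (g • y)) =
      Set.range fun y => dist (g • x) y - f y := by
    rw [← (MulAction.surjective g).range_comp fun y => dist (g • x) y - f y]
    simp [Function.comp_def]
  rw [h]
  exact hf (g • x)

/-- The action on extremal functions by translation, `(g • f)(x) = f(g⁻¹ • x)`. -/
noncomputable instance : MulAction G (InjectiveHull Y) where
  smul g f := ⟨fun x => f.1 (g⁻¹ • x), f.2.comp_smul g⁻¹⟩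
  one_smul f := Subtype.ext (funext fun x => by
    change f.1 ((1 : G)⁻¹ • x) = f.1 x
    rw [inv_one, one_smul])
  mul_smul g h f := Subtype.ext (funext fun x => by
    change f.1 ((g * h)⁻¹ • x) = f.1 (h⁻¹ • g⁻¹ • x)
    rw [mul_inv_rev, mul_smul])

theorem InjectiveHull.smul_of (g : G) (y : Y) : g • of y = of (g • y) := by
  refine Subtype.ext (funext fun x => ?_)
  change dist (g⁻¹ • x) y = dist x (g • y)
  rw [← dist_smul g, smul_inv_smul]

instance : IsIsometricSMul G (InjectiveHull Y) where
  isometry_smul g := by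
    refine Isometry.of_dist_eq fun f h => ?_
    exact (MulAction.surjective g⁻¹).iSup_comp (fun x => |f.1 x - h.1 x|)

end Hull

/-! ### Loxodromic elements -/

section Loxodromic

variable {G : Type u} [Group G] {S : Type v} [MetricSpace S] [HyperbolicSpace S] [MulAction G S]
  [IsIsometricSMul G S]

theorem smul_limit_eq_of_commute {f : ℕ → G} {s : S}
    (hf : ProductTendsToInfinity (fun k => f k • s) (fun k => f k • s)) {g : G}
    (hg : ∀ k, Commute g (f k)) :
    g • hf.limit = hf.limit := by
  rw [hf.smul_limit_eq_iff]
  refine hf.of_dist_le (C := dist s (g • s)) fun k => le_of_eq ?_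
  rw [smul_smul, (hg k).eq, mul_smul, dist_smul]

/-- An element whose positive and negative iterates converge to different boundary points is
loxodromic: if it fixed a third boundary point, its orbits would be bounded. -/
theorem isLoxodromic_of_productTendsToInfinity {f : G} {s : S}
    (h₁ : ProductTendsToInfinity (fun k : ℕ => f ^ k • s) (fun k : ℕ => f ^ k • s))
    (h₂ : ProductTendsToInfinity (fun k : ℕ => f⁻¹ ^ k • s) (fun k : ℕ => f⁻¹ ^ k • s))
    (hne : ¬ ProductTendsToInfinity (fun k : ℕ => f ^ k • s) (fun k : ℕ => f⁻¹ ^ k • s)) :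
    IsLoxodromic S f ∧ ∀ c : Boundary S, f • c = c →
      c = h₁.limit ∨ c = h₂.limit := by
  set a : Boundary S := h₁.limit with ha
  set b : Boundary S := h₂.limit with hb
  have hab : a ≠ b := fun h => hne ((h₁.limit_eq_iff h₂).1 h)
  have comm : ∀ g ∈ Subgroup.zpowers f, Commute g f := by
    rintro _ ⟨n, rfl⟩
    exact (Commute.refl f).zpow_left n
  have fa : ∀ g ∈ Subgroup.zpowers f, g • a = a := fun g hg =>
    smul_limit_eq_of_commute h₁ fun k => (comm g hg).pow_right k
  have fb : ∀ g ∈ Subgroup.zpowers f, g • b = b := fun g hg =>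
    smul_limit_eq_of_commute h₂ fun k => (comm g hg).inv_right.pow_right k
  have unbdd : ∀ C : ℝ, ∀ t : S, ∃ g ∈ Subgroup.zpowers f, C < dist t (g • t) := by
    intro C t
    obtain ⟨N, hN⟩ := (productTendsToInfinity_iff s).1 h₁ (C + 2 * dist t s + 1)
    refine ⟨f ^ N, Subgroup.npow_mem_zpowers f N, ?_⟩
    have h3 := hN N le_rfl N le_rfl
    rw [gromovProduct_self, dist_comm (f ^ N • s) s] at h3
    have h4 := dist_triangle4 s t (f ^ N • t) (f ^ N • s)
    rw [dist_smul, dist_comm s t] at h4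
    linarith
  have two : ∀ c : Boundary S, f • c = c → c = a ∨ c = b := by
    intro c hc
    by_contra! hne
    obtain ⟨C, hC⟩ := exists_dist_smul_le_of_fixes_three (G := G) hab hne.1.symm hne.2.symm s
    obtain ⟨g, hg, hgC⟩ := unbdd C s
    have hle : Subgroup.zpowers f ≤ MulAction.stabilizer G c := by
      rw [Subgroup.zpowers_le]
      exact hc
    exact hgC.not_ge (hC g (fa g hg) (fb g hg) (hle hg))
  refine ⟨⟨fun t hbd => ?_, ?_⟩, two⟩
  · obtain ⟨C, hC⟩ := hbd.subset_closedBall t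
    obtain ⟨g, hg, hgC⟩ := unbdd C t
    have := hC ⟨⟨g, hg⟩, rfl⟩
    rw [Metric.mem_closedBall, dist_comm] at this
    exact hgC.not_ge this
  · have hset : {c : Boundary S | ∀ g ∈ Subgroup.zpowers f, g • c = c} = {a, b} := by
      ext c
      constructor
      · intro hc
        exact two c (hc f (Subgroup.mem_zpowers f))
      · rintro (rfl | rfl)
        · exact fa
        · exact fb
    rw [hset]
    exact Set.encard_pair hab

theorem IsLoxodromic.exists_productTendsToInfinity {g : G} (hg : IsLoxodromic S g) (s : S) :
    ∃ (f : G) (h₁ : ProductTendsToInfinity (fun k : ℕ => f ^ k • s) (fun k : ℕ => f ^ k • s))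
      (h₂ : ProductTendsToInfinity (fun k : ℕ => f⁻¹ ^ k • s) (fun k : ℕ => f⁻¹ ^ k • s)),
      ¬ ProductTendsToInfinity (fun k : ℕ => f ^ k • s) (fun k : ℕ => f⁻¹ ^ k • s) ∧
      g • h₁.limit = h₁.limit ∧
      g • h₂.limit = h₂.limit := by
  obtain ⟨a, b, hab, hset⟩ := Set.encard_eq_two.1 hg.2
  have ha : ∀ h ∈ Subgroup.zpowers g, h • a = a := by
    have : a ∈ ({a, b} : Set (Boundary S)) := by simp
    rwa [← hset] at this
  have hb : ∀ h ∈ Subgroup.zpowers g, h • b = b := by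
    have : b ∈ ({a, b} : Set (Boundary S)) := by simp
    rwa [← hset] at this
  obtain ⟨x, rfl⟩ := exists_limit_eq a
  obtain ⟨y, rfl⟩ := exists_limit_eq b
  obtain ⟨f, -, h₁, h₂⟩ := exists_mem_zpowers_productTendsToInfinity (hg.1 s) hab ha hb
  have ex : (h₁.trans h₁.symm).limit = x.limit :=
    (ProductTendsToInfinity.limit_eq_seq_limit_iff _).2 h₁
  have ey : (h₂.trans h₂.symm).limit = y.limit :=
    (ProductTendsToInfinity.limit_eq_seq_limit_iff _).2 h₂
  refine ⟨f, h₁.trans h₁.symm, h₂.trans h₂.symm, fun h => hab ?_, ?_, ?_⟩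
  · exact limit_eq_limit_iff.2 (h₁.symm.trans (h.trans h₂))
  · rw [ex]
    exact ha g (Subgroup.mem_zpowers g)
  · rw [ey]
    exact hb g (Subgroup.mem_zpowers g)

/-- The orbits of the elliptic radical are bounded, since it fixes three boundary points. -/
theorem IsGeneralType.exists_dist_smul_le (hG : IsGeneralType G S) (s : S) :
    ∃ D : ℝ, ∀ e ∈ ellipticRadical G S, dist s (e • s) ≤ D := by
  obtain ⟨-, g, h, hg, hh, hgh⟩ := hG
  obtain ⟨f, h₁, h₂, hne, hfix₁, hfix₂⟩ := hg.exists_productTendsToInfinity s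
  obtain ⟨f', h₁', -, -, hfix', -⟩ := hh.exists_productTendsToInfinity s
  obtain ⟨D, hD⟩ := exists_dist_smul_le_of_fixes_three (G := G)
    (a := h₁.limit) (b := h₂.limit)
    (c := h₁'.limit) (fun h => hne ((h₁.limit_eq_iff h₂).1 h))
    (fun h => hgh ⟨_, hfix₁, h ▸ hfix'⟩) (fun h => hgh ⟨_, hfix₂, h ▸ hfix'⟩) s
  exact ⟨D, fun e he => hD e (he _ (limit_mem_limitSet _ h₁)) (he _ (limit_mem_limitSet _ h₂))
    (he _ (limit_mem_limitSet _ h₁'))⟩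

end Loxodromic

/-! ### Actions with roughly isometric orbits -/

section Transfer

variable {G Q : Type*} [Group G] [Group Q] {S T : Type*} [MetricSpace S] [HyperbolicSpace S]
  [MulAction G S] [IsIsometricSMul G S] [MetricSpace T] [HyperbolicSpace T] [MulAction Q T]
  [IsIsometricSMul Q T]

/-- Actions of general type are detected by a single orbit up to rough isometry, whatever the rest
of the space. -/
theorem IsGeneralType.of_roughly_isometric (hG : IsGeneralType G S) (π : G →* Q) (s : S) (t : T)
    {C : ℝ} (hC : ∀ g h : G, |dist (g • s) (h • s) - dist (π g • t) (π h • t)| ≤ C) :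
    IsGeneralType Q T := by
  have hC' : ∀ g h : G, |dist (π g • t) (π h • t) - dist (g • s) (h • s)| ≤ C := fun g h => by
    rw [abs_sub_comm]
    exact hC g h
  have back : ∀ u v : ℕ → G, ProductTendsToInfinity (fun n => π (u n) • t) (fun n => π (v n) • t) →
      ProductTendsToInfinity (fun n => u n • s) (fun n => v n • s) := fun u v h =>
    h.of_roughly_isometric (F := fun g => π g • t) (F' := fun g : G => g • s) hC'
  have forth : ∀ u v : ℕ → G, ProductTendsToInfinity (fun n => u n • s) (fun n => v n • s) →
      ProductTendsToInfinity (fun n => π (u n) • t) (fun n => π (v n) • t) := fun u v h =>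
    h.of_roughly_isometric (F := fun g : G => g • s) (F' := fun g => π g • t) hC
  obtain ⟨-, g, h, hg, hh, hgh⟩ := hG
  obtain ⟨f, h₁, h₂, hne, hfix₁, hfix₂⟩ := hg.exists_productTendsToInfinity s
  obtain ⟨f', h₁', h₂', hne', hfix₁', hfix₂'⟩ := hh.exists_productTendsToInfinity s
  have lox : ∀ f : G,
      ProductTendsToInfinity (fun k : ℕ => f ^ k • s) (fun k : ℕ => f ^ k • s) →
      ProductTendsToInfinity (fun k : ℕ => f⁻¹ ^ k • s) (fun k : ℕ => f⁻¹ ^ k • s) →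
      ¬ ProductTendsToInfinity (fun k : ℕ => f ^ k • s) (fun k : ℕ => f⁻¹ ^ k • s) →
      IsLoxodromic T (π f) ∧ ∀ c : Boundary T, π f • c = c → ∃ (u : ℕ → G)
        (hu : ProductTendsToInfinity (fun k => π (u k) • t) (fun k => π (u k) • t)),
        c = hu.limit ∧ ((u = fun k => f ^ k) ∨ u = fun k => f⁻¹ ^ k) := by
    intro f h₁ h₂ hne
    have e₁ := forth _ _ h₁
    have e₂ := forth _ _ h₂
    have e₃ := mt (back _ _) hne
    have e₁' := e₁
    have e₂' := e₂
    simp only [map_pow, map_inv] at e₁' e₂' e₃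
    obtain ⟨hl, hfix⟩ := isLoxodromic_of_productTendsToInfinity e₁' e₂' e₃
    refine ⟨hl, fun c hc => ?_⟩
    rcases hfix c hc with h | h
    · exact ⟨_, e₁, by simpa only [map_pow] using h, Or.inl rfl⟩
    · exact ⟨_, e₂, by simpa only [map_pow, map_inv] using h, Or.inr rfl⟩
  obtain ⟨l, hl⟩ := lox f h₁ h₂ hne
  obtain ⟨l', hl'⟩ := lox f' h₁' h₂' hne'
  refine ⟨fun t hb => l.1 t (hb.subset ?_), π f, π f', l, l', ?_⟩
  · rintro _ ⟨q, rfl⟩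
    exact ⟨q.1, rfl⟩
  · rintro ⟨c, hc, hc'⟩
    obtain ⟨u, hu, rfl, hu'⟩ := hl c hc
    obtain ⟨w, hw, hcw, hw'⟩ := hl' _ hc'
    have huw := back _ _ ((hu.limit_eq_iff hw).1 hcw)
    -- A common fixed point of `π f` and `π f'` gives a common fixed point of `g` and `h`.
    have gu : g • (back _ _ hu).limit = (back _ _ hu).limit := by
      rcases hu' with rfl | rfl
      · exact hfix₁
      · exact hfix₂
    have gw : h • (back _ _ hw).limit = (back _ _ hw).limit := by
      rcases hw' with rfl | rfl
      · exact hfix₁'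
      · exact hfix₂'
    have e : (back _ _ hu).limit = (back _ _ hw).limit :=
      (ProductTendsToInfinity.limit_eq_iff _ _).2 huw
    exact hgh ⟨_, gu, e ▸ gw⟩

/-- Every point of the limit set of `G` in `S` is the limit of a sequence in the orbit of `s`; the
corresponding sequence in the orbit of `t` has its limit in the limit set of `Q` in `T`. -/
theorem mem_ellipticRadical_of_roughly_isometric (π : G →* Q) (s : S) (t : T)
    {C : ℝ} (hC : ∀ g h : G, |dist (g • s) (h • s) - dist (π g • t) (π h • t)| ≤ C) {g : G}
    (hg : ∀ a ∈ limitSet Q T, π g • a = a) : g ∈ ellipticRadical G S := by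
  intro a ha
  obtain ⟨u, hu, rfl⟩ := exists_limit_eq_of_mem_limitSet ha s
  have hu' : ProductTendsToInfinity (fun n => π (u n) • t) (fun n => π (u n) • t) :=
    hu.of_roughly_isometric (F := fun g : G => g • s) (F' := fun g => π g • t) hC
  have h1 := hg _ (limit_mem_limitSet (fun n => π (u n)) hu')
  rw [ProductTendsToInfinity.smul_limit_eq_iff] at h1 ⊢
  have h2 : ProductTendsToInfinity (fun n => π (g * u n) • t) (fun n => π (u n) • t) := by
    simpa only [map_mul, mul_smul] using h1
  have h3 : ProductTendsToInfinity (fun n => (g * u n) • s) (fun n => u n • s) :=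
    h2.of_roughly_isometric (F := fun g => π g • t) (F' := fun g : G => g • s) fun g h => by
      rw [abs_sub_comm]
      exact hC g h
  simpa only [mul_smul] using h3

end Transfer

/-! ### The pseudometric on the orbits of normal subgroups -/

section OrbitDist

variable {G : Type u} [Group G]

/-- A copy of the space `X`, to carry the pseudometric of the distances between the orbits of the
subgroup `N`. -/
def ModSubgroup (_ : Subgroup G) (X : Type v) : Type v := X

variable (N : Subgroup G) {X : Type v} [MetricSpace X] [MulAction G X]

/-- The distance of `x` from the `N`-orbit of `y`. -/
noncomputable def orbitDist (x y : X) : ℝ :=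
  ⨅ n : N, dist x ((n : G) • y)

variable {N}

theorem orbitDist_le {n : G} (hn : n ∈ N) (x y : X) : orbitDist N x y ≤ dist x (n • y) :=
  ciInf_le (f := fun n : N => dist x ((n : G) • y)) ⟨0, by rintro _ ⟨n, rfl⟩; exact dist_nonneg⟩
    ⟨n, hn⟩

theorem orbitDist_nonneg (x y : X) : 0 ≤ orbitDist N x y :=
  le_ciInf fun _ => dist_nonneg

theorem orbitDist_smul_self {n : G} (hn : n ∈ N) (x : X) : orbitDist N (n • x) x = 0 :=
  le_antisymm ((orbitDist_le hn _ _).trans (dist_self _).le) (orbitDist_nonneg _ _)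

theorem orbitDist_le_dist (x y : X) : orbitDist N x y ≤ dist x y := by
  simpa using orbitDist_le N.one_mem x y

variable [IsIsometricSMul G X]

theorem orbitDist_le_comm (x y : X) : orbitDist N x y ≤ orbitDist N y x := by
  refine le_ciInf fun n => (orbitDist_le (inv_mem n.2) x y).trans_eq ?_
  rw [← dist_smul (n : G) x, smul_inv_smul, dist_comm]

theorem orbitDist_triangle (x y z : X) :
    orbitDist N x z ≤ orbitDist N x y + orbitDist N y z := by
  refine le_ciInf_add_ciInf fun m n => (orbitDist_le (mul_mem m.2 n.2) x z).trans ?_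
  rw [mul_smul, ← dist_smul (m : G) y]
  exact dist_triangle _ _ _

theorem orbitDist_smul_le [hN : N.Normal] (g : G) (x y : X) :
    orbitDist N (g • x) (g • y) ≤ orbitDist N x y := by
  refine le_ciInf fun n => (orbitDist_le (hN.conj_mem n n.2 g) _ _).trans_eq ?_
  rw [mul_smul, mul_smul, inv_smul_smul, dist_smul]

noncomputable instance : PseudoMetricSpace (ModSubgroup N X) where
  dist x y := orbitDist (X := X) N x y
  dist_self x := le_antisymm ((orbitDist_le_dist _ _).trans (dist_self _).le) (orbitDist_nonneg _ _)
  dist_comm x y := le_antisymm (orbitDist_le_comm _ _) (orbitDist_le_comm _ _)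
  dist_triangle x y z := orbitDist_triangle _ _ _

instance : MulAction G (ModSubgroup N X) := inferInstanceAs (MulAction G X)

instance [N.Normal] : IsIsometricSMul G (ModSubgroup N X) where
  isometry_smul g := by
    refine Isometry.of_dist_eq fun x y => le_antisymm (orbitDist_smul_le g _ _) ?_
    have h : ∀ z w : X, orbitDist N z w ≤ orbitDist N (g • z) (g • w) := fun z w => by
      simpa only [inv_smul_smul] using orbitDist_smul_le (N := N) g⁻¹ (g • z) (g • w)
    exact h x y

theorem InjectiveHull.smul_eq_of_mem [N.Normal] {n : G} (hn : n ∈ N)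
    (f : InjectiveHull (ModSubgroup N X)) : n • f = f :=
  Subtype.ext (funext fun x => f.2.eq_of_dist_eq_zero (orbitDist_smul_self (X := X) (inv_mem hn) x))

/-- The action of `G ⧸ N` on the injective hull of `X` with the distance of `N`-orbits: extremal
functions are constant on `N`-orbits. -/
noncomputable instance [N.Normal] : MulAction (G ⧸ N) (InjectiveHull (ModSubgroup N X)) :=
  MulAction.compHom _ (QuotientGroup.lift N
    (MulAction.toPermHom G (InjectiveHull (ModSubgroup N X)))
    fun _ hn => Equiv.ext fun f => InjectiveHull.smul_eq_of_mem hn f)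

theorem InjectiveHull.mk_smul [N.Normal] (g : G) (f : InjectiveHull (ModSubgroup N X)) :
    (g : G ⧸ N) • f = g • f := rfl

instance [N.Normal] : IsIsometricSMul (G ⧸ N) (InjectiveHull (ModSubgroup N X)) where
  isometry_smul q := by
    obtain ⟨g, rfl⟩ := QuotientGroup.mk_surjective q
    exact isometry_smul (InjectiveHull (ModSubgroup N X)) g

end OrbitDist

instance isIsometricSMul_orbit {G : Type u} [Group G] {S : Type v} [MetricSpace S] [MulAction G S]
    [IsIsometricSMul G S] (s : S) : IsIsometricSMul G (MulAction.orbit G s) where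
  isometry_smul g := Isometry.of_dist_eq fun x y => dist_smul g (x : S) (y : S)

end WeakHyp

/-! ### The quotient by the elliptic radical -/

theorem mainTheorem3 {G : Type u} [Group G] {S : Type v} [MetricSpace S]
    [WeakHyp.HyperbolicSpace S] [MulAction G S] [IsIsometricSMul G S]
    (hG : WeakHyp.IsGeneralType G S) :
    WeakHyp.IsFaithfulWeaklyHyperbolic.{u, v} (G ⧸ WeakHyp.ellipticRadical G S) := by
  open WeakHyp in
  obtain ⟨δ, hδ⟩ := fourPoint_exists S
  obtain ⟨s⟩ : Nonempty S := by
    obtain ⟨-, g, -, ⟨-, hg⟩, -⟩ := hG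
    obtain ⟨a, ha⟩ := Set.nonempty_of_encard_ne_zero (hg.trans_ne two_ne_zero)
    obtain ⟨x, -⟩ := exists_limit_eq a
    exact ⟨x.1 0⟩
  obtain ⟨D, hD⟩ := hG.exists_dist_smul_le s
  let E := ellipticRadical G S
  -- On the single orbit `X` all orbits of `E` have diameter at most `D`, since `E` is normal.
  let X := MulAction.orbit G s
  have hle : ∀ x y : X, dist x y ≤ orbitDist E x y + D := by
    rintro x ⟨_, g, rfl⟩
    rw [← sub_le_iff_le_add]
    refine le_ciInf fun e => ?_
    rw [sub_le_iff_le_add]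
    refine (dist_triangle x ((e : G) • ⟨g • s, g, rfl⟩) _).trans (add_le_add le_rfl ?_)
    have h1 := hD _ ((ellipticRadical_normal G S).conj_mem e e.2 g⁻¹)
    rw [← dist_smul g, dist_comm] at h1
    simp only [inv_inv, mul_smul, smul_inv_smul] at h1
    exact h1
  have : Nonempty (ModSubgroup E X) := ⟨(⟨s, 1, one_smul G s⟩ : X)⟩
  have hyp : HyperbolicSpace (InjectiveHull (ModSubgroup E X)) := by
    refine hyperbolicSpace_injectiveHull (δ := δ + D) fun x y z w => ?_
    change orbitDist (X := X) E x y + orbitDist (X := X) E z w ≤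
      max (orbitDist (X := X) E x z + orbitDist (X := X) E y w)
        (orbitDist (X := X) E x w + orbitDist (X := X) E y z) + 2 * (δ + D)
    have h1 : dist (α := X) x y + dist (α := X) z w ≤
        max (dist (α := X) x z + dist (α := X) y w) (dist (α := X) x w + dist (α := X) y z)
          + 2 * δ :=
      hδ.dist_add_dist_le (Subtype.val (p := (· ∈ X)) x) (Subtype.val (p := (· ∈ X)) y)
        (Subtype.val (p := (· ∈ X)) z) (Subtype.val (p := (· ∈ X)) w)
    have h2 := orbitDist_le_dist (N := E) (X := X) x y
    have h3 := orbitDist_le_dist (N := E) (X := X) z w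
    rw [← sub_le_iff_le_add, le_max_iff] at h1 ⊢
    rcases h1 with h1 | h1
    · left
      linarith [hle x z, hle y w]
    · right
      linarith [hle x w, hle y z]
  let p : ModSubgroup E X := (⟨s, 1, one_smul G s⟩ : X)
  have hC : ∀ g h : G, |dist (g • s) (h • s) -
      dist (QuotientGroup.mk' E g • InjectiveHull.of p)
        (QuotientGroup.mk' E h • InjectiveHull.of p)| ≤ D := by
    intro g h
    have e : dist (QuotientGroup.mk' E g • InjectiveHull.of p)
        (QuotientGroup.mk' E h • InjectiveHull.of p) =
        orbitDist (X := X) E (g • ⟨s, 1, one_smul G s⟩) (h • ⟨s, 1, one_smul G s⟩) := by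
      rw [QuotientGroup.mk'_apply, QuotientGroup.mk'_apply, InjectiveHull.mk_smul,
        InjectiveHull.mk_smul, InjectiveHull.smul_of, InjectiveHull.smul_of,
        InjectiveHull.dist_of_of]
      rfl
    rw [e, abs_le]
    have h1 := hle (g • ⟨s, 1, one_smul G s⟩) (h • ⟨s, 1, one_smul G s⟩)
    have h2 := orbitDist_le_dist (N := E) (X := X) (g • ⟨s, 1, one_smul G s⟩)
      (h • ⟨s, 1, one_smul G s⟩)
    have h3 : dist (α := X) (g • ⟨s, 1, one_smul G s⟩) (h • ⟨s, 1, one_smul G s⟩) =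
      dist (g • s) (h • s) := rfl
    have h4 := (dist_nonneg).trans (hD 1 (one_mem _))
    constructor <;> linarith
  refine ⟨InjectiveHull (ModSubgroup E X), inferInstance, hyp, inferInstance, inferInstance,
    hG.of_roughly_isometric (QuotientGroup.mk' E) s (InjectiveHull.of p) hC, fun q hq => ?_⟩
  obtain ⟨g, rfl⟩ := QuotientGroup.mk_surjective q
  rw [QuotientGroup.eq_one_iff]
  exact mem_ellipticRadical_of_roughly_isometric (QuotientGroup.mk' E) s (InjectiveHull.of p) hC hq
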